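/- Let $D=\,]0,+\infty[\,\times\mathbb{R}$. For $z=(t,x_1,x_2)$ and $w=(T,y_1,y_2)$ in $\mathbb{R}\times D$ write $z\prec w$ if $t<T$ and $x_2<y_2$. For $z\prec w$ consider the controls $\omega\in L^2([t,T])$ for which there is an absolutely continuous curve $\gamma=(\gamma_1,\gamma_2):[t,T]\to D$ with $$\dot\gamma_1(s)=\omega(s)\gamma_1(s),\qquad \dot\gamma_2(s)=\gamma_1(s)\quad\text{for a.e. } s\in[t,T],\qquad \gamma(t)=(x_1,x_2),\quad \gamma(T)=(y_1,y_2),$$ and let $\Psi(z;w)=\min_\omega\int_t^T|\omega(s)|^2\,ds$ be the minimum over all such controls; a control that attains it is called optimal. Put $Y=\partial_t+x_1\partial_{x_2}$. **Lemma (HJB equation).** Let $w=(T,y)\in\mathbb{R}\times D$. Then $\Psi(\cdot;w)$ is differentiable at every $z=(t,x)\in\mathbb{R}\times D$ with $z\prec w$ and satisfies there $$Y\Psi(z;w)=\Big(\frac{x_1}{2}\,\partial_{x_1}\Psi(z;w)\Big)^2 .$$ Furthermore, for every such $z$ the minimum defining $\Psi(z;w)$ is attained, and every optimal control $\omega$,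 with trajectory $\gamma$, satisfies $$\omega(s)=-\frac{\gamma_1(s)}{2}\,\partial_{x_1}\Psi\big(s,\gamma(s);w\big)\qquad\text{for a.e. } s\in[t,T];$$ moreover there is an optimal control that is continuous on $[t,T]$ and satisfies this identity for every $s\in[t,T[$. -/

import Mathlib

open MeasureTheory Set

namespace AsianControl

/-- The state space `D = ]0, +∞[ × ℝ`. -/
def D : Set (ℝ × ℝ) := {x | 0 < x.1}

/-- The relation `z ≺ w` between `z = (t, x₁, x₂)` and `w = (T, y₁, y₂)`: `t < T` and `x₂ < y₂`. -/
def Prec (z w : ℝ × ℝ × ℝ) : Prop := z.1 < w.1 ∧ z.2.2 < w.2.2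

/-- `ω ∈ L²([t, T])` and `γ = (γ₁, γ₂)` is a curve in `D` that solves
`γ₁' = ω γ₁`, `γ₂' = γ₁` on `[t, T]` with `γ(t) = x` and `γ(T) = y`, where `z = (t, x)` and
`w = (T, y)`. As `ω` is only an `L²` function, the equations hold in the sense of Carathéodory:
`γ` is continuous and satisfies the integrated equations (whose integrands are integrable,
so that `γ` is absolutely continuous). -/
structure IsTrajectory (z w : ℝ × ℝ × ℝ) (ω : ℝ → ℝ) (γ : ℝ → ℝ × ℝ) : Prop where
  memLp : MemLp ω 2 (volume.restrict (Icc z.1 w.1))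
  mem_D : ∀ s ∈ Icc z.1 w.1, γ s ∈ D
  continuousOn : ContinuousOn γ (Icc z.1 w.1)
  fst_eq : ∀ s ∈ Icc z.1 w.1, (γ s).1 = z.2.1 + ∫ r in z.1..s, ω r * (γ r).1
  snd_eq : ∀ s ∈ Icc z.1 w.1, (γ s).2 = z.2.2 + ∫ r in z.1..s, (γ r).1
  left_eq : γ z.1 = z.2
  right_eq : γ w.1 = w.2

/-- The cost `∫_t^T |ω(s)|² ds` of a control. -/
noncomputable def cost (z w : ℝ × ℝ × ℝ) (ω : ℝ → ℝ) : ℝ := ∫ s in z.1..w.1, |ω s| ^ 2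

/-- The cost function `Ψ(z; w)`: the infimum of the costs of all the controls that steer `z`
to `w`. (Only its values for `z ≺ w` matter, where such controls exist.) -/
noncomputable def Psi (z w : ℝ × ℝ × ℝ) : ℝ :=
  sInf {c : ℝ | ∃ ω γ, IsTrajectory z w ω γ ∧ c = cost z w ω}

/-- `ω` is an optimal control for the problem of steering `z` to `w`, with trajectory `γ`. -/
def IsOptimal (z w : ℝ × ℝ × ℝ) (ω : ℝ → ℝ) (γ : ℝ → ℝ × ℝ) : Prop :=
  IsTrajectory z w ω γ ∧ ∀ ω' γ', IsTrajectory z w ω' γ' → cost z w ω ≤ cost z w ω'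

/-- The partial derivative `∂_t u` at `z = (t, x₁, x₂)`. -/
noncomputable def partialT (u : ℝ × ℝ × ℝ → ℝ) (z : ℝ × ℝ × ℝ) : ℝ :=
  deriv (fun r => u (r, z.2.1, z.2.2)) z.1

/-- The partial derivative `∂_{x₁} u` at `z = (t, x₁, x₂)`. -/
noncomputable def partialX1 (u : ℝ × ℝ × ℝ → ℝ) (z : ℝ × ℝ × ℝ) : ℝ :=
  deriv (fun r => u (z.1, r, z.2.2)) z.2.1

/-- The partial derivative `∂_{x₂} u` at `z = (t, x₁, x₂)`. -/
noncomputable def partialX2 (u : ℝ × ℝ × ℝ → ℝ) (z : ℝ × ℝ × ℝ) : ℝ :=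
  deriv (fun r => u (z.1, z.2.1, r)) z.2.2

/-- The vector field `Y = ∂_t + x₁ ∂_{x₂}`. -/
noncomputable def fieldY (u : ℝ × ℝ × ℝ → ℝ) (z : ℝ × ℝ × ℝ) : ℝ :=
  partialT u z + z.2.1 * partialX2 u z

end AsianControl

/-! The proof is a verification argument with an explicit candidate V = `value w`. Put τ = T - t, A
= y₂ - x₂, ρ = √(x₁y₁), and write C(m) = cosh √m, S(m) = sinh √m / √m, continued analytically to m <
0. The parameter m > -π² is the unique solution of S(m) = A/(τρ), and V = 4m/τ + 4(x₁ + y₁)/A -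
8C(m)ρ/A.

The identity C² - mS² = 1 turns into the HJB equation for V (`valueT_add_mul_valueX2`). Hence along
any trajectory dV/ds + ω² is the square of the defect ω + (γ₁/2)∂V/∂x₁, and integration up to s < T
(`integral_sq_eq`) writes the cost so far as V(z) - V(s,γ(s)) plus the integrated defect.

V is singular at w, so the limit s → T is handled by two one-sided facts. An upper bound of
V(s,γ(s)) that tends to 0 gives cost ≥ V(z) + defect; V ≥ 0 gives cost ≤ V(z) when the defect
vanishes. The explicit curve γ₁ = v⁻², v'' = kv, k = m/τ², has zero defect. So Ψ = V, the minimum is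
attained, and any optimal control has zero defect almost everywhere. -/

open Filter Topology

namespace AsianControl

/-! ### The entire functions C and S, and the inverse of S on ]-π², +∞[ -/

section PowerSeries

variable {a : ℕ → ℝ}

theorem summable_mul_pow_of_le (ha : ∀ n, |a n| ≤ 1 / (n.factorial : ℝ)) (m : ℝ) :
    Summable fun n => a n * m ^ n := by
  refine Summable.of_norm_bounded (Real.summable_pow_div_factorial |m|) fun n => ?_
  rw [norm_mul, norm_pow, Real.norm_eq_abs, Real.norm_eq_abs]
  calc |a n| * |m| ^ n ≤ 1 / (n.factorial : ℝ) * |m| ^ n := by gcongr; exact ha n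
    _ = _ := by ring

theorem hasDerivAt_tsum_mul_pow (ha : ∀ n, |a n| ≤ 1 / (n.factorial : ℝ)) (m : ℝ) :
    HasDerivAt (fun x => ∑' n, a n * x ^ n) (∑' n, (n + 1) * a (n + 1) * m ^ n) m := by
  set R := |m| + 1 with hR
  have hRpos : 0 < R := by positivity
  set u : ℕ → ℝ := fun n => n * R ^ (n - 1) / n.factorial with hu
  have husum : Summable u := by
    rw [← summable_nat_add_iff 1]
    refine (Real.summable_pow_div_factorial R).congr fun n => ?_
    simp only [hu, Nat.add_sub_cancel, Nat.factorial_succ]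
    push_cast
    field_simp
  have hm : m ∈ Metric.ball (0 : ℝ) R := by simp [hR]
  have hbound : ∀ n (y : ℝ), y ∈ Metric.ball (0 : ℝ) R → ‖a n * (n * y ^ (n - 1))‖ ≤ u n := by
    intro n y hy
    have hy' : |y| ≤ R := by
      have := mem_ball_zero_iff.1 hy
      rw [Real.norm_eq_abs] at this
      exact this.le
    rw [norm_mul, norm_mul, norm_pow, Real.norm_eq_abs, Real.norm_eq_abs, Real.norm_eq_abs,
      Nat.abs_cast]
    calc |a n| * (n * |y| ^ (n - 1)) ≤ 1 / (n.factorial : ℝ) * (n * R ^ (n - 1)) := by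
          gcongr
          exact ha n
      _ = u n := by simp only [hu]; ring
  have h := hasDerivAt_tsum_of_isPreconnected (g := fun n x => a n * x ^ n)
    (g' := fun n y => a n * (n * y ^ (n - 1))) husum Metric.isOpen_ball
    (convex_ball (0 : ℝ) R).isPreconnected
    (fun n y _ => (hasDerivAt_pow n y).const_mul (a n)) hbound hm
    (summable_mul_pow_of_le ha m) hm
  refine h.congr_deriv ?_
  have hs : Summable fun n : ℕ => a n * (n * m ^ (n - 1)) :=
    Summable.of_norm_bounded husum fun n => hbound n m hm
  -- The term n = 0 vanishes through its factor n, so the truncated exponent n - 1 does no harm.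
  rw [hs.tsum_eq_zero_add]
  simp only [Nat.cast_zero, zero_mul, mul_zero, zero_add, Nat.add_sub_cancel]
  refine tsum_congr fun n => ?_
  push_cast
  ring

end PowerSeries

/-- The entire function whose value at `x ^ 2` is `cosh x` and whose value at `-x ^ 2` is `cos x`. -/
noncomputable def coshSqrt (m : ℝ) : ℝ := ∑' n : ℕ, 1 / ((2 * n).factorial : ℝ) * m ^ n

/-- The entire function whose value at `x ^ 2` is `sinh x / x` and whose value at `-x ^ 2` is
`sin x / x`. -/
noncomputable def sinhcSqrt (m : ℝ) : ℝ := ∑' n : ℕ, 1 / ((2 * n + 1).factorial : ℝ) * m ^ n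

/-- The derivative of `sinhcSqrt`. -/
noncomputable def sinhcSqrtDeriv (m : ℝ) : ℝ :=
  ∑' n : ℕ, (n + 1) * (1 / ((2 * n + 3).factorial : ℝ)) * m ^ n

theorem abs_one_div_factorial_le {n k : ℕ} (h : n ≤ k) :
    |1 / (k.factorial : ℝ)| ≤ 1 / (n.factorial : ℝ) := by
  rw [abs_of_pos (by positivity)]
  exact one_div_le_one_div_of_le (by positivity) (by exact_mod_cast Nat.factorial_le h)

theorem coshSqrt_coeff_le (n : ℕ) :
    |1 / ((2 * n).factorial : ℝ)| ≤ 1 / (n.factorial : ℝ) :=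
  abs_one_div_factorial_le (by lia)

theorem sinhcSqrt_coeff_le (n : ℕ) :
    |1 / ((2 * n + 1).factorial : ℝ)| ≤ 1 / (n.factorial : ℝ) :=
  abs_one_div_factorial_le (by lia)

theorem sinhcSqrtDeriv_coeff_le (n : ℕ) :
    |(n + 1) * (1 / ((2 * n + 3).factorial : ℝ))| ≤ 1 / (n.factorial : ℝ) := by
  rw [abs_mul]
  have h := abs_one_div_factorial_le (show n + 1 ≤ 2 * n + 3 by lia)
  calc |(n : ℝ) + 1| * |1 / ((2 * n + 3).factorial : ℝ)|
      ≤ (n + 1) * (1 / ((n + 1).factorial : ℝ)) := by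
        rw [abs_of_pos (show (0 : ℝ) < n + 1 by positivity)]
        gcongr
    _ = 1 / (n.factorial : ℝ) := by
        rw [Nat.factorial_succ]
        push_cast
        field_simp

theorem hasDerivAt_coshSqrt (m : ℝ) : HasDerivAt coshSqrt (sinhcSqrt m / 2) m := by
  refine (hasDerivAt_tsum_mul_pow coshSqrt_coeff_le m).congr_deriv ?_
  rw [sinhcSqrt, ← tsum_div_const]
  refine tsum_congr fun n => ?_
  rw [show 2 * (n + 1) = 2 * n + 1 + 1 by ring, Nat.factorial_succ (2 * n + 1)]
  push_cast
  field_simp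
  ring

theorem hasDerivAt_sinhcSqrt (m : ℝ) : HasDerivAt sinhcSqrt (sinhcSqrtDeriv m) m :=
  hasDerivAt_tsum_mul_pow sinhcSqrt_coeff_le m

theorem continuous_coshSqrt : Continuous coshSqrt :=
  continuous_iff_continuousAt.2 fun m => (hasDerivAt_coshSqrt m).continuousAt

theorem continuous_sinhcSqrt : Continuous sinhcSqrt :=
  continuous_iff_continuousAt.2 fun m => (hasDerivAt_sinhcSqrt m).continuousAt

theorem continuous_sinhcSqrtDeriv : Continuous sinhcSqrtDeriv :=
  continuous_iff_continuousAt.2 fun m =>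
    (hasDerivAt_tsum_mul_pow sinhcSqrtDeriv_coeff_le m).continuousAt

theorem coshSqrt_sq (x : ℝ) : coshSqrt (x ^ 2) = Real.cosh x := by
  rw [Real.cosh_eq_tsum, coshSqrt]
  refine tsum_congr fun n => ?_
  rw [← pow_mul]
  ring

theorem coshSqrt_neg_sq (x : ℝ) : coshSqrt (-x ^ 2) = Real.cos x := by
  rw [Real.cos_eq_tsum, coshSqrt]
  refine tsum_congr fun n => ?_
  rw [neg_pow, ← pow_mul]
  ring

theorem mul_sinhcSqrt_sq (x : ℝ) : x * sinhcSqrt (x ^ 2) = Real.sinh x := by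
  rw [Real.sinh_eq_tsum, sinhcSqrt, ← tsum_mul_left]
  refine tsum_congr fun n => ?_
  rw [← pow_mul]
  ring

theorem mul_sinhcSqrt_neg_sq (x : ℝ) : x * sinhcSqrt (-x ^ 2) = Real.sin x := by
  rw [Real.sin_eq_tsum, sinhcSqrt, ← tsum_mul_left]
  refine tsum_congr fun n => ?_
  rw [neg_pow, ← pow_mul]
  ring

theorem exists_eq_sq_or_neg_sq (m : ℝ) : ∃ x : ℝ, 0 ≤ x ∧ (m = x ^ 2 ∨ m = -x ^ 2) := by
  rcases le_total 0 m with h | h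
  · exact ⟨√m, Real.sqrt_nonneg _, Or.inl (Real.sq_sqrt h).symm⟩
  · exact ⟨√(-m), Real.sqrt_nonneg _, Or.inr (by rw [Real.sq_sqrt (by linarith)]; ring)⟩

theorem coshSqrt_sq_sub (m : ℝ) : coshSqrt m ^ 2 - m * sinhcSqrt m ^ 2 = 1 := by
  obtain ⟨x, -, rfl | rfl⟩ := exists_eq_sq_or_neg_sq m
  · rw [coshSqrt_sq, ← mul_pow, mul_sinhcSqrt_sq, Real.cosh_sq_sub_sinh_sq]
  · rw [coshSqrt_neg_sq, neg_mul, ← mul_pow, mul_sinhcSqrt_neg_sq]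
    linarith [Real.sin_sq_add_cos_sq x]

@[simp] theorem coshSqrt_zero : coshSqrt 0 = 1 := by
  simpa using coshSqrt_sq 0

/-- Comparing coefficients, rather than differentiating sinh √m / √m, covers m = 0 and both signs of
m at once. -/
theorem two_mul_sinhcSqrtDeriv (m : ℝ) :
    2 * m * sinhcSqrtDeriv m = coshSqrt m - sinhcSqrt m := by
  have hC := summable_mul_pow_of_le coshSqrt_coeff_le m
  have hS := summable_mul_pow_of_le sinhcSqrt_coeff_le m
  rw [coshSqrt, sinhcSqrt, ← hC.tsum_sub hS, (hC.sub hS).tsum_eq_zero_add, sinhcSqrtDeriv,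
    ← tsum_mul_left]
  simp only [mul_zero, Nat.factorial_zero, Nat.cast_one, pow_zero, zero_add, Nat.factorial_one,
    sub_self]
  refine tsum_congr fun n => ?_
  rw [show 2 * (n + 1) = 2 * n + 2 by ring, show 2 * n + 2 + 1 = 2 * n + 3 by ring,
    Nat.factorial_succ (2 * n + 2)]
  push_cast
  field_simp
  ring

@[simp] theorem sinhcSqrt_zero : sinhcSqrt 0 = 1 := by
  have := two_mul_sinhcSqrtDeriv 0
  rw [coshSqrt_zero] at this
  linarith

theorem sin_sub_mul_cos_pos {x : ℝ} (h0 : 0 < x) (h1 : x < Real.pi) :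
    0 < Real.sin x - x * Real.cos x := by
  have hs := Real.sin_pos_of_pos_of_lt_pi h0 h1
  rcases lt_or_ge x (Real.pi / 2) with h | h
  · have hc : 0 < Real.cos x := Real.cos_pos_of_mem_Ioo ⟨by linarith, h⟩
    have := Real.lt_tan h0 h
    rw [Real.tan_eq_sin_div_cos, lt_div_iff₀ hc] at this
    linarith
  · have hc : Real.cos x ≤ 0 := Real.cos_nonpos_of_pi_div_two_le_of_le h (by linarith)
    nlinarith

/-- For m ≥ 0 all coefficients are positive. For m = -x² with 0 < x < π, 2x³S'(m) = sin x - x cos x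
> 0. -/
theorem sinhcSqrtDeriv_pos {m : ℝ} (hm : -Real.pi ^ 2 < m) : 0 < sinhcSqrtDeriv m := by
  rcases le_or_gt 0 m with h | h
  · have := (summable_mul_pow_of_le sinhcSqrtDeriv_coeff_le m).le_tsum 0
      fun n _ => by positivity
    refine lt_of_lt_of_le ?_ this
    simp [Nat.factorial]
  · obtain ⟨x, hx0, rfl | rfl⟩ := exists_eq_sq_or_neg_sq m
    · nlinarith
    · have hx : 0 < x := lt_of_le_of_ne hx0 (by rintro rfl; simp at h)
      have hpi : x < Real.pi := by
        have : x ^ 2 < Real.pi ^ 2 := by linarith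
        exact lt_of_pow_lt_pow_left₀ 2 Real.pi_pos.le this
      have key := two_mul_sinhcSqrtDeriv (-x ^ 2)
      have hpos := sin_sub_mul_cos_pos hx hpi
      rw [coshSqrt_neg_sq] at key
      have h3 : 2 * x ^ 3 * sinhcSqrtDeriv (-x ^ 2) = Real.sin x - x * Real.cos x := by
        rw [← mul_sinhcSqrt_neg_sq x]
        linear_combination -x * key
      rw [← h3] at hpos
      exact pos_of_mul_pos_right hpos (by positivity)

theorem strictMonoOn_sinhcSqrt : StrictMonoOn sinhcSqrt (Ici (-Real.pi ^ 2)) := by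
  refine strictMonoOn_of_deriv_pos (convex_Ici _) continuous_sinhcSqrt.continuousOn fun m hm => ?_
  rw [interior_Ici] at hm
  rw [(hasDerivAt_sinhcSqrt m).deriv]
  exact sinhcSqrtDeriv_pos hm

theorem sinhcSqrt_neg_pi_sq : sinhcSqrt (-Real.pi ^ 2) = 0 := by
  have := mul_sinhcSqrt_neg_sq Real.pi
  rw [Real.sin_pi] at this
  exact (mul_eq_zero.1 this).resolve_left Real.pi_ne_zero

theorem sinhcSqrt_pos {m : ℝ} (hm : -Real.pi ^ 2 < m) : 0 < sinhcSqrt m := by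
  rw [← sinhcSqrt_neg_pi_sq]
  exact strictMonoOn_sinhcSqrt self_mem_Ici hm.le hm

/-- Linear growth makes S surjective onto ]0, +∞[: it gives S(6r) ≥ 1 + r. -/
theorem one_add_div_six_le_sinhcSqrt {m : ℝ} (hm : 0 ≤ m) : 1 + m / 6 ≤ sinhcSqrt m := by
  have := (summable_mul_pow_of_le sinhcSqrt_coeff_le m).sum_le_tsum (Finset.range 2)
      fun n _ => by positivity
  refine le_trans (le_of_eq ?_) this
  simp [Finset.sum_range_succ, Nat.factorial]
  ring

theorem exists_sinhcSqrt_eq {r : ℝ} (hr : 0 < r) : ∃ m ∈ Ioi (-Real.pi ^ 2), sinhcSqrt m = r := by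
  have hle : -Real.pi ^ 2 ≤ 6 * r := by nlinarith [sq_nonneg Real.pi]
  have hmem : r ∈ Icc (sinhcSqrt (-Real.pi ^ 2)) (sinhcSqrt (6 * r)) := by
    rw [sinhcSqrt_neg_pi_sq]
    refine ⟨hr.le, ?_⟩
    linarith [one_add_div_six_le_sinhcSqrt (show 0 ≤ 6 * r by positivity)]
  obtain ⟨m, hm, rfl⟩ := intermediate_value_Icc hle continuous_sinhcSqrt.continuousOn hmem
  refine ⟨m, lt_of_le_of_ne hm.1 ?_, rfl⟩
  rintro rfl
  rw [sinhcSqrt_neg_pi_sq] at hr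
  exact lt_irrefl _ hr

/-- The inverse of `sinhcSqrt` as a bijection from `]-π², +∞[` onto `]0, +∞[`. -/
noncomputable def invSinhcSqrt : ℝ → ℝ := Function.invFunOn sinhcSqrt (Ioi (-Real.pi ^ 2))

theorem invSinhcSqrt_mem {r : ℝ} (hr : 0 < r) : -Real.pi ^ 2 < invSinhcSqrt r :=
  Function.invFunOn_mem (exists_sinhcSqrt_eq hr)

theorem sinhcSqrt_invSinhcSqrt {r : ℝ} (hr : 0 < r) : sinhcSqrt (invSinhcSqrt r) = r :=
  Function.invFunOn_eq (exists_sinhcSqrt_eq hr)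

theorem invSinhcSqrt_sinhcSqrt {m : ℝ} (hm : -Real.pi ^ 2 < m) :
    invSinhcSqrt (sinhcSqrt m) = m :=
  strictMonoOn_sinhcSqrt.injOn (invSinhcSqrt_mem (sinhcSqrt_pos hm)).le hm.le
    (sinhcSqrt_invSinhcSqrt (sinhcSqrt_pos hm))

theorem strictMonoOn_invSinhcSqrt : StrictMonoOn invSinhcSqrt (Ioi 0) := by
  intro r hr s hs hrs
  rw [← sinhcSqrt_invSinhcSqrt hr, ← sinhcSqrt_invSinhcSqrt hs] at hrs
  exact (strictMonoOn_sinhcSqrt.lt_iff_lt (invSinhcSqrt_mem hr).le (invSinhcSqrt_mem hs).le).1 hrs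

theorem continuousAt_invSinhcSqrt {r : ℝ} (hr : 0 < r) : ContinuousAt invSinhcSqrt r := by
  refine strictMonoOn_invSinhcSqrt.continuousAt_of_image_mem_nhds (Ioi_mem_nhds hr) ?_
  refine mem_of_superset (Ioi_mem_nhds (invSinhcSqrt_mem hr)) fun m hm => ?_
  exact ⟨sinhcSqrt m, sinhcSqrt_pos hm, invSinhcSqrt_sinhcSqrt hm⟩

theorem hasDerivAt_invSinhcSqrt {r : ℝ} (hr : 0 < r) :
    HasDerivAt invSinhcSqrt (sinhcSqrtDeriv (invSinhcSqrt r))⁻¹ r :=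
  HasDerivAt.of_local_left_inverse (continuousAt_invSinhcSqrt hr) (hasDerivAt_sinhcSqrt _)
    (sinhcSqrtDeriv_pos (invSinhcSqrt_mem hr)).ne'
    (eventually_of_mem (Ioi_mem_nhds hr) fun _ hs => sinhcSqrt_invSinhcSqrt hs)

@[simp] theorem invSinhcSqrt_one : invSinhcSqrt 1 = 0 := by
  have := invSinhcSqrt_sinhcSqrt (m := 0) (by simp [Real.pi_pos])
  rwa [sinhcSqrt_zero] at this

/-- C' = S/2 is increasing, so C is convex and lies above its tangents. The tangent at m, evaluated
at 0, yields V ≥ 0; the tangent at 0 yields the upper bound of V near w. -/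
theorem add_mul_sinhcSqrt_le_coshSqrt {m₀ m : ℝ} (h₀ : -Real.pi ^ 2 < m₀)
    (h : -Real.pi ^ 2 < m) :
    coshSqrt m₀ + sinhcSqrt m₀ / 2 * (m - m₀) ≤ coshSqrt m := by
  have hconv : ConvexOn ℝ (Ioi (-Real.pi ^ 2)) coshSqrt := by
    refine MonotoneOn.convexOn_of_deriv (convex_Ioi _) continuous_coshSqrt.continuousOn
      (fun x _ => (hasDerivAt_coshSqrt x).differentiableAt.differentiableWithinAt) ?_
    rw [interior_Ioi]
    intro x hx y hy hxy
    rw [(hasDerivAt_coshSqrt x).deriv, (hasDerivAt_coshSqrt y).deriv]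
    have := strictMonoOn_sinhcSqrt.monotoneOn (mem_Ici.2 (le_of_lt hx)) (mem_Ici.2 (le_of_lt hy))
      hxy
    linarith
  have hd := hasDerivAt_coshSqrt m₀
  rcases lt_trichotomy m₀ m with hlt | rfl | hlt
  · have := hconv.le_slope_of_hasDerivAt h₀ h hlt hd
    rw [slope_def_field, le_div_iff₀ (by linarith)] at this
    linarith
  · simp
  · have := hconv.slope_le_of_hasDerivAt h h₀ hlt hd
    rw [slope_def_field, div_le_iff₀ (by linarith)] at this
    linarith

end AsianControl

/-! ### The closed form V: derivatives, HJB equation, bounds -/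

namespace AsianControl

/-- The parameter `m = k (T - t) ^ 2`, where `γ₁ ^ (-1/2)` solves `v'' = k v` along the optimal
trajectory that steers `z` to `w`. -/
noncomputable def rate (w z : ℝ × ℝ × ℝ) : ℝ :=
  invSinhcSqrt ((w.2.2 - z.2.2) / ((w.1 - z.1) * √(z.2.1 * w.2.1)))

/-- The closed form of the cost function. -/
noncomputable def value (w z : ℝ × ℝ × ℝ) : ℝ :=
  4 * rate w z * (w.1 - z.1)⁻¹ + 4 * (z.2.1 + w.2.1) * (w.2.2 - z.2.2)⁻¹ -
    8 * coshSqrt (rate w z) * √(z.2.1 * w.2.1) * (w.2.2 - z.2.2)⁻¹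

/-- The `t`-derivative of `value w`. -/
noncomputable def valueT (w z : ℝ × ℝ × ℝ) : ℝ := 4 * rate w z / (w.1 - z.1) ^ 2

/-- The `x₁`-derivative of `value w`. -/
noncomputable def valueX1 (w z : ℝ × ℝ × ℝ) : ℝ :=
  4 / (w.2.2 - z.2.2) -
    4 * coshSqrt (rate w z) * w.2.1 / (√(z.2.1 * w.2.1) * (w.2.2 - z.2.2))

/-- The `x₂`-derivative of `value w`. -/
noncomputable def valueX2 (w z : ℝ × ℝ × ℝ) : ℝ :=
  (4 * (z.2.1 + w.2.1) - 8 * coshSqrt (rate w z) * √(z.2.1 * w.2.1)) / (w.2.2 - z.2.2) ^ 2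

variable {w z : ℝ × ℝ × ℝ}

theorem sinhcSqrt_rate (hw : 0 < w.2.1) (hz : 0 < z.2.1) (h : Prec z w) :
    sinhcSqrt (rate w z) = (w.2.2 - z.2.2) / ((w.1 - z.1) * √(z.2.1 * w.2.1)) := by
  have h1 := sub_pos.2 h.1
  have h2 := sub_pos.2 h.2
  exact sinhcSqrt_invSinhcSqrt (by positivity)

/-- Stated along a curve, it serves both for the partial derivatives and for trajectories. It is an
envelope argument: with m as a free variable, ∂V/∂m = 4/τ - 4Sρ/A, which vanishes at S = A/(τρ). -/
theorem hasDerivAt_value_comp {t x₁ x₂ : ℝ → ℝ} {t' x₁' x₂' s : ℝ} (hw : 0 < w.2.1)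
    (hz : 0 < x₁ s) (h : Prec (t s, x₁ s, x₂ s) w) (ht : HasDerivAt t t' s)
    (hx₁ : HasDerivAt x₁ x₁' s) (hx₂ : HasDerivAt x₂ x₂' s) :
    HasDerivAt (fun r => value w (t r, x₁ r, x₂ r))
      (t' * valueT w (t s, x₁ s, x₂ s) + x₁' * valueX1 w (t s, x₁ s, x₂ s) +
        x₂' * valueX2 w (t s, x₁ s, x₂ s)) s := by
  have h1 : 0 < w.1 - t s := sub_pos.2 h.1
  have h2 : 0 < w.2.2 - x₂ s := sub_pos.2 h.2
  have hS := sinhcSqrt_rate (z := (t s, x₁ s, x₂ s)) hw hz h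
  have hsq : 0 < √(x₁ s * w.2.1) := by positivity
  have hsq2 : √(x₁ s * w.2.1) ^ 2 = x₁ s * w.2.1 := Real.sq_sqrt (by positivity)
  have hτ : HasDerivAt (fun r => w.1 - t r) (-t') s := by simpa using ht.const_sub w.1
  have hA : HasDerivAt (fun r => w.2.2 - x₂ r) (-x₂') s := by simpa using hx₂.const_sub w.2.2
  have hρ := (hx₁.mul_const w.2.1).sqrt (by positivity)
  have hr := hA.fun_div (hτ.fun_mul hρ) (by positivity)
  have hm : HasDerivAt (fun r => rate w (t r, x₁ r, x₂ r)) _ s :=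
    (hasDerivAt_invSinhcSqrt (by positivity)).comp s hr
  have hC : HasDerivAt (fun r => coshSqrt (rate w (t r, x₁ r, x₂ r))) _ s :=
    (hasDerivAt_coshSqrt _).comp s hm
  have hV := (((hm.const_mul 4).fun_mul (hτ.fun_inv h1.ne')).fun_add
    (((hx₁.add_const w.2.1).const_mul 4).fun_mul (hA.fun_inv h2.ne'))).fun_sub
    (((hC.const_mul 8).fun_mul hρ).fun_mul (hA.fun_inv h2.ne'))
  refine hV.congr_deriv ?_
  clear hV hC hm hr hρ hA hτ
  simp only [valueT, valueX1, valueX2]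
  simp only at hS
  rw [hS]
  -- The derivative of m may stay unknown, since its coefficient is zero.
  generalize (sinhcSqrtDeriv _)⁻¹ * _ = m'
  generalize coshSqrt _ = c
  generalize rate _ _ = m
  generalize √(x₁ s * w.2.1) = ρ at *
  generalize w.1 - t s = τ at *
  generalize w.2.2 - x₂ s = A at *
  field_simp
  ring

theorem differentiableAt_value (hw : 0 < w.2.1) (hz : 0 < z.2.1) (h : Prec z w) :
    DifferentiableAt ℝ (value w) z := by
  have h1 : 0 < w.1 - z.1 := sub_pos.2 h.1
  have h2 : 0 < w.2.2 - z.2.2 := sub_pos.2 h.2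
  have h3 : z.2.1 * w.2.1 ≠ 0 := by positivity
  have hρ : DifferentiableAt ℝ (fun ζ : ℝ × ℝ × ℝ => √(ζ.2.1 * w.2.1)) z :=
    DifferentiableAt.sqrt (by fun_prop) h3
  have hm : DifferentiableAt ℝ (rate w) z := by
    have hn : DifferentiableAt ℝ (fun ζ : ℝ × ℝ × ℝ => w.2.2 - ζ.2.2) z := by fun_prop
    have hd : DifferentiableAt ℝ (fun ζ : ℝ × ℝ × ℝ => (w.1 - ζ.1) * √(ζ.2.1 * w.2.1)) z := by
      fun_prop
    have hd0 : (w.1 - z.1) * √(z.2.1 * w.2.1) ≠ 0 := by positivity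
    have hg : DifferentiableAt ℝ invSinhcSqrt
        ((w.2.2 - z.2.2) / ((w.1 - z.1) * √(z.2.1 * w.2.1))) :=
      (hasDerivAt_invSinhcSqrt (by positivity)).differentiableAt
    refine DifferentiableAt.comp z hg ?_
    simp only [div_eq_mul_inv]
    exact hn.fun_mul (hd.fun_inv hd0)
  have hC : DifferentiableAt ℝ (fun ζ => coshSqrt (rate w ζ)) z :=
    DifferentiableAt.comp (g := coshSqrt) z (hasDerivAt_coshSqrt _).differentiableAt hm
  have hτ : DifferentiableAt ℝ (fun ζ : ℝ × ℝ × ℝ => (w.1 - ζ.1)⁻¹) z :=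
    DifferentiableAt.inv (by fun_prop) h1.ne'
  have hA : DifferentiableAt ℝ (fun ζ : ℝ × ℝ × ℝ => (w.2.2 - ζ.2.2)⁻¹) z :=
    DifferentiableAt.inv (by fun_prop) h2.ne'
  unfold value
  fun_prop

theorem valueT_add_mul_valueX2 (hw : 0 < w.2.1) (hz : 0 < z.2.1) (h : Prec z w) :
    valueT w z + z.2.1 * valueX2 w z = (z.2.1 / 2 * valueX1 w z) ^ 2 := by
  have h1 : 0 < w.1 - z.1 := sub_pos.2 h.1
  have h2 : 0 < w.2.2 - z.2.2 := sub_pos.2 h.2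
  have hS := sinhcSqrt_rate hw hz h
  have hC := coshSqrt_sq_sub (rate w z)
  rw [hS] at hC
  have hsq : 0 < √(z.2.1 * w.2.1) := by positivity
  have hsq2 : √(z.2.1 * w.2.1) ^ 2 = z.2.1 * w.2.1 := Real.sq_sqrt (by positivity)
  simp only [valueT, valueX1, valueX2]
  generalize coshSqrt _ = c at *
  generalize rate _ _ = m at *
  generalize √(z.2.1 * w.2.1) = ρ at *
  generalize w.1 - z.1 = τ at *
  generalize w.2.2 - z.2.2 = A at *
  generalize z.2.1 = x at *
  generalize w.2.1 = y at *
  have hy : y = ρ ^ 2 / x := by field_simp; linarith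
  subst hy
  -- C² - mS² = 1 eliminates m, and the HJB equation becomes a rational identity.
  have hm : m = (c ^ 2 - 1) * (τ * ρ) ^ 2 / A ^ 2 := by
    field_simp
    field_simp at hC
    linarith
  subst hm
  field_simp
  ring

theorem add_sub_two_mul_sqrt_nonneg {x y : ℝ} (hx : 0 ≤ x) (hy : 0 ≤ y) :
    0 ≤ x + y - 2 * √(x * y) := by
  rw [Real.sqrt_mul hx]
  nlinarith [sq_nonneg (√x - √y), Real.sq_sqrt hx, Real.sq_sqrt hy]

theorem value_nonneg (hw : 0 < w.2.1) (hz : 0 < z.2.1) (h : Prec z w) : 0 ≤ value w z := by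
  have h1 : 0 < w.1 - z.1 := sub_pos.2 h.1
  have h2 : 0 < w.2.2 - z.2.2 := sub_pos.2 h.2
  have hS := sinhcSqrt_rate hw hz h
  have hr : -Real.pi ^ 2 < rate w z := invSinhcSqrt_mem (by positivity)
  have htan := add_mul_sinhcSqrt_le_coshSqrt hr (show -Real.pi ^ 2 < 0 by simp [Real.pi_pos])
  have hρ := add_sub_two_mul_sqrt_nonneg hz.le hw.le
  rw [hS, coshSqrt_zero] at htan
  have hsq : 0 < √(z.2.1 * w.2.1) := by positivity
  unfold value
  generalize coshSqrt _ = c at *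
  generalize rate _ _ = m at *
  generalize √(z.2.1 * w.2.1) = ρ at *
  generalize w.1 - z.1 = τ at *
  generalize w.2.2 - z.2.2 = A at *
  -- V splits into the gap of the tangent inequality and a multiple of (√x₁ - √y₁)².
  have e : 4 * m * τ⁻¹ + 4 * (z.2.1 + w.2.1) * A⁻¹ - 8 * c * ρ * A⁻¹ =
      8 * (ρ / A) * (1 - (c + A / (τ * ρ) / 2 * (0 - m))) +
        4 * (z.2.1 + w.2.1 - 2 * ρ) / A := by
    field_simp
    ring
  rw [e]
  have := sub_nonneg.2 htan
  positivity

/-- First-order terms cancel: replacing C(m) by its lower bound 1 + m/2 leaves 4/τ times m(A -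
τρ)/A, a product of two factors O(e), and the gap x₁ + y₁ - 2ρ = O(e²) divided by A. -/
theorem exists_value_le {T y₁ y₂ : ℝ} (hy : 0 < y₁) :
    ∃ K η : ℝ, 0 < η ∧ ∀ t x₁ x₂ e : ℝ, t < T → 0 ≤ e → e < η → |x₁ - y₁| ≤ e →
      |y₂ - x₂ - (T - t) * y₁| ≤ (T - t) * e →
      value (T, y₁, y₂) (t, x₁, x₂) ≤ K * (e ^ 2 / (T - t)) := by
  -- As S(0) = 1, this gives |m| ≤ c|A/(τρ) - 1| near ratio 1.
  obtain ⟨c, hc⟩ := (hasDerivAt_invSinhcSqrt one_pos).isBigO_sub.bound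
  obtain ⟨δ, hδ, hball⟩ := Metric.eventually_nhds_iff.1 hc
  -- e < y₁/2 keeps ρ and A/τ above y₁/2; e < δy₁/4 keeps the ratio within δ of 1.
  refine ⟨(64 * |c| + 8) / y₁ ^ 2, min (y₁ / 2) (δ * y₁ / 4), by positivity, ?_⟩
  intro t x₁ x₂ e ht he heη hx hA
  have he1 : e < y₁ / 2 := lt_of_lt_of_le heη (min_le_left _ _)
  have he2 : e < δ * y₁ / 4 := lt_of_lt_of_le heη (min_le_right _ _)
  have hτ : 0 < T - t := sub_pos.2 ht
  have hx' := abs_le.1 hx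
  have hx1 : y₁ / 2 < x₁ := by linarith
  have hx1pos : 0 < x₁ := by linarith
  have hρ1 : y₁ - e ≤ √(x₁ * y₁) := Real.le_sqrt_of_sq_le (by nlinarith)
  have hρ2 : √(x₁ * y₁) ≤ y₁ + e := Real.sqrt_le_iff.2 ⟨by linarith, by nlinarith⟩
  have hA' := abs_le.1 hA
  have hApos : (T - t) * (y₁ / 2) < y₂ - x₂ := by nlinarith
  have hA0 : 0 < y₂ - x₂ := lt_trans (by positivity) hApos
  have hP : Prec (t, x₁, x₂) (T, y₁, y₂) := ⟨ht, sub_pos.1 hA0⟩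
  have hr : -Real.pi ^ 2 < rate (T, y₁, y₂) (t, x₁, x₂) := invSinhcSqrt_mem (by
    simp only
    positivity)
  have htan := add_mul_sinhcSqrt_le_coshSqrt (show -Real.pi ^ 2 < 0 by simp [Real.pi_pos]) hr
  have hρ := add_sub_two_mul_sqrt_nonneg hx1pos.le hy.le
  have hsq2 : √(x₁ * y₁) ^ 2 = x₁ * y₁ := Real.sq_sqrt (by positivity)
  rw [coshSqrt_zero, sinhcSqrt_zero] at htan
  have hρ0 : y₁ / 2 < √(x₁ * y₁) := by linarith
  have hρpos : 0 < √(x₁ * y₁) := by linarith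
  have hτρ : |y₂ - x₂ - (T - t) * √(x₁ * y₁)| ≤ (T - t) * (2 * e) := by
    rw [abs_le]
    constructor <;> nlinarith
  have hdist : |(y₂ - x₂) / ((T - t) * √(x₁ * y₁)) - 1| ≤ 4 * e / y₁ := by
    rw [div_sub_one (by positivity), abs_div,
      abs_of_pos (show 0 < (T - t) * √(x₁ * y₁) by positivity)]
    refine (div_le_div₀ (by positivity) hτρ (by positivity)
      (mul_le_mul_of_nonneg_left hρ0.le hτ.le)).trans (le_of_eq ?_)
    field_simp
    ring
  have hm : |rate (T, y₁, y₂) (t, x₁, x₂)| ≤ |c| * (4 * e / y₁) := by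
    have hlt : dist ((y₂ - x₂) / ((T - t) * √(x₁ * y₁))) 1 < δ := by
      rw [Real.dist_eq]
      refine hdist.trans_lt ?_
      rw [div_lt_iff₀ hy]
      linarith
    have := hball hlt
    rw [invSinhcSqrt_one, sub_zero, Real.norm_eq_abs, Real.norm_eq_abs] at this
    exact this.trans (mul_le_mul (le_abs_self c) hdist (abs_nonneg _) (abs_nonneg _))
  have hA1 : |(y₂ - x₂ - (T - t) * √(x₁ * y₁)) / (y₂ - x₂)| ≤ 4 * e / y₁ := by
    rw [abs_div, abs_of_pos hA0]
    refine (div_le_div₀ (by positivity) hτρ (by positivity) hApos.le).trans (le_of_eq ?_)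
    field_simp
    ring
  have hgap : x₁ + y₁ - 2 * √(x₁ * y₁) ≤ e ^ 2 / y₁ := by
    rw [le_div_iff₀ hy]
    have hsq := sq_le_sq' hx'.1 hx'.2
    nlinarith
  have hgap2 : (x₁ + y₁ - 2 * √(x₁ * y₁)) / (y₂ - x₂) ≤ e ^ 2 / y₁ / ((T - t) * (y₁ / 2)) :=
    div_le_div₀ (by positivity) hgap (by positivity) hApos.le
  have hprod := (le_abs_self _).trans ((abs_mul _ _).le.trans
    (mul_le_mul hm hA1 (abs_nonneg _) (by positivity)))
  unfold value
  simp only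
  generalize coshSqrt _ = C at *
  generalize rate _ _ = m at *
  generalize √(x₁ * y₁) = ρ at *
  generalize T - t = τ at *
  generalize y₂ - x₂ = A at *
  calc 4 * m * τ⁻¹ + 4 * (x₁ + y₁) * A⁻¹ - 8 * C * ρ * A⁻¹
      = 4 / τ * (m * ((A - τ * ρ) / A)) + 4 * ((x₁ + y₁ - 2 * ρ) / A) -
          8 * ρ / A * (C - (1 + 1 / 2 * (m - 0))) := by
        field_simp
        ring
    _ ≤ 4 / τ * (|c| * (4 * e / y₁) * (4 * e / y₁)) + 4 * (e ^ 2 / y₁ / (τ * (y₁ / 2))) - 0 := by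
        gcongr
        have := sub_nonneg.2 htan
        positivity
    _ = (64 * |c| + 8) / y₁ ^ 2 * (e ^ 2 / τ) := by
        field_simp
        ring

end AsianControl

/-! ### Absolute continuity under composition, and Cauchy–Schwarz -/

theorem AbsolutelyContinuousOnInterval.congr {X : Type*} [PseudoMetricSpace X] {f g : ℝ → X}
    {a b : ℝ} (hf : AbsolutelyContinuousOnInterval f a b) (h : EqOn f g (uIcc a b)) :
    AbsolutelyContinuousOnInterval g a b := by
  rw [absolutelyContinuousOnInterval_iff] at hf ⊢
  intro ε hε
  obtain ⟨δ, hδ, H⟩ := hf ε hε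
  refine ⟨δ, hδ, fun E hE hlt => ?_⟩
  have := H E hE hlt
  rwa [Finset.sum_congr rfl fun i hi => by rw [h (hE.1 i hi).1, h (hE.1 i hi).2]] at this

theorem LipschitzOnWith.comp_absolutelyContinuousOnInterval {X Y : Type*} [PseudoMetricSpace X]
    [PseudoMetricSpace Y] {h : X → Y} {f : ℝ → X} {K : NNReal} {s : Set X} {a b : ℝ}
    (hh : LipschitzOnWith K h s) (hf : AbsolutelyContinuousOnInterval f a b)
    (hs : MapsTo f (uIcc a b) s) : AbsolutelyContinuousOnInterval (fun x => h (f x)) a b := by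
  rw [absolutelyContinuousOnInterval_iff] at hf ⊢
  intro ε hε
  obtain ⟨δ, hδ, H⟩ := hf (ε / (K + 1)) (by positivity)
  refine ⟨δ, hδ, fun E hE hlt => ?_⟩
  calc ∑ i ∈ Finset.range E.1, dist (h (f (E.2 i).1)) (h (f (E.2 i).2))
      ≤ ∑ i ∈ Finset.range E.1, K * dist (f (E.2 i).1) (f (E.2 i).2) :=
        Finset.sum_le_sum fun i hi =>
          hh.dist_le_mul _ (hs (hE.1 i hi).1) _ (hs (hE.1 i hi).2)
    _ = K * ∑ i ∈ Finset.range E.1, dist (f (E.2 i).1) (f (E.2 i).2) :=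
        (Finset.mul_sum _ _ _).symm
    _ ≤ K * (ε / (K + 1)) := by gcongr; exact (H E hE hlt).le
    _ < (K + 1) * (ε / (K + 1)) := by gcongr; linarith
    _ = ε := by field_simp

/-- The range of f lies in a compact interval of ]0, +∞[, on which h is Lipschitz. -/
theorem AbsolutelyContinuousOnInterval.comp_of_hasDerivAt_Ioi {h h' f : ℝ → ℝ} {a b : ℝ}
    (hf : AbsolutelyContinuousOnInterval f a b) (hpos : ∀ x ∈ uIcc a b, 0 < f x)
    (hh : ∀ y, 0 < y → HasDerivAt h (h' y) y) (hh' : ContinuousOn h' (Ioi 0)) :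
    AbsolutelyContinuousOnInterval (fun x => h (f x)) a b := by
  obtain ⟨p, hp, hmin⟩ := isCompact_uIcc.exists_isMinOn nonempty_uIcc hf.continuousOn
  obtain ⟨q, hq, hmax⟩ := isCompact_uIcc.exists_isMaxOn nonempty_uIcc hf.continuousOn
  have hsub : Icc (f p) (f q) ⊆ Ioi 0 := fun y hy => lt_of_lt_of_le (hpos p hp) hy.1
  obtain ⟨C, hC⟩ := isCompact_Icc.exists_bound_of_continuousOn (hh'.mono hsub)
  have hC0 : 0 ≤ C := (norm_nonneg _).trans (hC (f p) ⟨le_rfl, hmin hq⟩)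
  have hL : LipschitzOnWith C.toNNReal h (Icc (f p) (f q)) :=
    (convex_Icc _ _).lipschitzOnWith_of_nnnorm_hasDerivWithin_le
      (fun y hy => (hh y (hsub hy)).hasDerivWithinAt) fun y hy => by
        rw [← NNReal.coe_le_coe, Real.coe_toNNReal C hC0]
        exact hC y hy
  exact hL.comp_absolutelyContinuousOnInterval hf fun x hx => ⟨hmin hx, hmax hx⟩

theorem AbsolutelyContinuousOnInterval.inv_of_pos {f : ℝ → ℝ} {a b : ℝ}
    (hf : AbsolutelyContinuousOnInterval f a b) (hpos : ∀ x ∈ uIcc a b, 0 < f x) :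
    AbsolutelyContinuousOnInterval (fun x => (f x)⁻¹) a b :=
  hf.comp_of_hasDerivAt_Ioi hpos (fun _ hy => hasDerivAt_inv hy.ne') <|
    ContinuousOn.neg <| ContinuousOn.inv₀ (by fun_prop) fun y (hy : 0 < y) => by positivity

theorem AbsolutelyContinuousOnInterval.sqrt_of_pos {f : ℝ → ℝ} {a b : ℝ}
    (hf : AbsolutelyContinuousOnInterval f a b) (hpos : ∀ x ∈ uIcc a b, 0 < f x) :
    AbsolutelyContinuousOnInterval (fun x => √(f x)) a b :=
  hf.comp_of_hasDerivAt_Ioi hpos (fun _ hy => Real.hasDerivAt_sqrt hy.ne') <|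
    continuousOn_const.div (by fun_prop) fun _ hy => by
      have := Real.sqrt_pos.2 hy
      positivity

theorem absolutelyContinuousOnInterval_const {X : Type*} [PseudoMetricSpace X] (c : X) (a b : ℝ) :
    AbsolutelyContinuousOnInterval (fun _ => c) a b :=
  ((LipschitzWith.const c).lipschitzOnWith (s := uIcc a b)).absolutelyContinuousOnInterval

theorem absolutelyContinuousOnInterval_id (a b : ℝ) :
    AbsolutelyContinuousOnInterval (fun x => x) a b :=
  (LipschitzWith.id.lipschitzOnWith (s := uIcc a b)).absolutelyContinuousOnInterval

/-- Expand the nonnegative integral of the squared deviation of |f| from its mean. -/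
theorem sq_intervalIntegral_abs_le {f : ℝ → ℝ} {a b : ℝ} (hab : a < b)
    (hf : IntervalIntegrable f volume a b)
    (hf2 : IntervalIntegrable (fun x => f x ^ 2) volume a b) :
    (∫ x in a..b, |f x|) ^ 2 ≤ (b - a) * ∫ x in a..b, f x ^ 2 := by
  set I := ∫ x in a..b, |f x| with hI
  have hτ : 0 < b - a := sub_pos.2 hab
  have h0 : 0 ≤ ∫ x in a..b, (|f x| - I / (b - a)) ^ 2 :=
    intervalIntegral.integral_nonneg hab.le fun x _ => sq_nonneg _
  have h1 : ∫ x in a..b, (|f x| - I / (b - a)) ^ 2 =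
      (∫ x in a..b, f x ^ 2) - 2 * (I / (b - a)) * I + (I / (b - a)) ^ 2 * (b - a) := by
    have e : ∀ x, (|f x| - I / (b - a)) ^ 2 =
        f x ^ 2 - 2 * (I / (b - a)) * |f x| + (I / (b - a)) ^ 2 := fun x => by
      rw [sub_sq, sq_abs]
      ring
    simp_rw [e]
    rw [intervalIntegral.integral_add (hf2.sub (hf.abs.const_mul _)) intervalIntegrable_const,
      intervalIntegral.integral_sub hf2 (hf.abs.const_mul _),
      intervalIntegral.integral_const_mul, intervalIntegral.integral_const, ← hI, smul_eq_mul]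
    ring
  rw [h1] at h0
  have h2 : 2 * (I / (b - a)) * I = 2 * I ^ 2 / (b - a) := by ring
  have h3 : (I / (b - a)) ^ 2 * (b - a) = I ^ 2 / (b - a) := by field_simp
  rw [h2, h3] at h0
  have h4 : I ^ 2 / (b - a) ≤ ∫ x in a..b, f x ^ 2 := by
    have : 2 * I ^ 2 / (b - a) = I ^ 2 / (b - a) + I ^ 2 / (b - a) := by ring
    linarith
  rw [div_le_iff₀ hτ] at h4
  linarith

/-! ### Verification along arbitrary trajectories -/

namespace AsianControl

variable {w z : ℝ × ℝ × ℝ} {ω : ℝ → ℝ} {γ : ℝ → ℝ × ℝ}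

/-- With ω only in L², V along γ is differentiable only almost everywhere; absolute continuity is
what allows its derivative to be integrated. -/
theorem absolutelyContinuousOnInterval_value {x₁ x₂ : ℝ → ℝ} {a b : ℝ} (hw : 0 < w.2.1)
    (h₁ : AbsolutelyContinuousOnInterval x₁ a b) (h₂ : AbsolutelyContinuousOnInterval x₂ a b)
    (hpos : ∀ s ∈ uIcc a b, 0 < x₁ s) (hP : ∀ s ∈ uIcc a b, Prec (s, x₁ s, x₂ s) w) :
    AbsolutelyContinuousOnInterval (fun s => value w (s, x₁ s, x₂ s)) a b := by
  have hτ : AbsolutelyContinuousOnInterval (fun s => w.1 - s) a b :=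
    (absolutelyContinuousOnInterval_const w.1 a b).sub (absolutelyContinuousOnInterval_id a b)
  have hτ0 : ∀ s ∈ uIcc a b, 0 < w.1 - s := fun s hs => sub_pos.2 (hP s hs).1
  have hA : AbsolutelyContinuousOnInterval (fun s => w.2.2 - x₂ s) a b :=
    (absolutelyContinuousOnInterval_const w.2.2 a b).sub h₂
  have hA0 : ∀ s ∈ uIcc a b, 0 < w.2.2 - x₂ s := fun s hs => sub_pos.2 (hP s hs).2
  have hρ : AbsolutelyContinuousOnInterval (fun s => √(x₁ s * w.2.1)) a b :=
    (h₁.fun_mul (absolutelyContinuousOnInterval_const w.2.1 a b)).sqrt_of_pos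
      fun s hs => mul_pos (hpos s hs) hw
  have hρ0 : ∀ s ∈ uIcc a b, 0 < √(x₁ s * w.2.1) := fun s hs =>
    Real.sqrt_pos.2 (mul_pos (hpos s hs) hw)
  have hr : AbsolutelyContinuousOnInterval
      (fun s => (w.2.2 - x₂ s) / ((w.1 - s) * √(x₁ s * w.2.1))) a b := by
    simp only [div_eq_mul_inv]
    exact hA.fun_mul ((hτ.fun_mul hρ).inv_of_pos fun s hs => mul_pos (hτ0 s hs) (hρ0 s hs))
  have hr0 : ∀ s ∈ uIcc a b, 0 < (w.2.2 - x₂ s) / ((w.1 - s) * √(x₁ s * w.2.1)) :=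
    fun s hs => div_pos (hA0 s hs) (mul_pos (hτ0 s hs) (hρ0 s hs))
  have hΘ : ContinuousOn invSinhcSqrt (Ioi 0) := fun r hr =>
    (continuousAt_invSinhcSqrt hr).continuousWithinAt
  have hΘ' : ContinuousOn (fun r => (sinhcSqrtDeriv (invSinhcSqrt r))⁻¹) (Ioi 0) :=
    (continuous_sinhcSqrtDeriv.comp_continuousOn hΘ).inv₀ fun r hr =>
      (sinhcSqrtDeriv_pos (invSinhcSqrt_mem hr)).ne'
  have hm : AbsolutelyContinuousOnInterval (fun s => rate w (s, x₁ s, x₂ s)) a b :=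
    hr.comp_of_hasDerivAt_Ioi hr0 (fun r hr => hasDerivAt_invSinhcSqrt hr) hΘ'
  have hC : AbsolutelyContinuousOnInterval (fun s => coshSqrt (rate w (s, x₁ s, x₂ s))) a b :=
    hr.comp_of_hasDerivAt_Ioi hr0 (h := fun r => coshSqrt (invSinhcSqrt r))
      (fun r hr => (hasDerivAt_coshSqrt _).comp r (hasDerivAt_invSinhcSqrt hr))
      (((continuous_sinhcSqrt.comp_continuousOn hΘ).div_const 2).mul hΘ')
  exact (((hm.const_mul 4).fun_mul (hτ.inv_of_pos hτ0)).add
    (((h₁.add (absolutelyContinuousOnInterval_const w.2.1 a b)).const_mul 4).fun_mul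
      (hA.inv_of_pos hA0))).sub (((hC.const_mul 8).fun_mul hρ).fun_mul (hA.inv_of_pos hA0))

namespace IsTrajectory

theorem intervalIntegrable (H : IsTrajectory z w ω γ) (hzw : z.1 ≤ w.1) :
    IntervalIntegrable ω volume z.1 w.1 := by
  rw [intervalIntegrable_iff_integrableOn_Icc_of_le hzw]
  exact H.memLp.integrable (by norm_num)

theorem intervalIntegrable_sq (H : IsTrajectory z w ω γ) (hzw : z.1 ≤ w.1) :
    IntervalIntegrable (fun s => ω s ^ 2) volume z.1 w.1 := by
  rw [intervalIntegrable_iff_integrableOn_Icc_of_le hzw]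
  exact H.memLp.integrable_sq

theorem continuousOn_fst (H : IsTrajectory z w ω γ) (hzw : z.1 ≤ w.1) :
    ContinuousOn (fun s => (γ s).1) (uIcc z.1 w.1) := by
  rw [uIcc_of_le hzw]
  exact continuous_fst.comp_continuousOn H.continuousOn

theorem intervalIntegrable_mul (H : IsTrajectory z w ω γ) (hzw : z.1 ≤ w.1) :
    IntervalIntegrable (fun s => ω s * (γ s).1) volume z.1 w.1 :=
  (H.intervalIntegrable hzw).mul_continuousOn (H.continuousOn_fst hzw)

theorem absolutelyContinuousOnInterval_fst (H : IsTrajectory z w ω γ) (hzw : z.1 ≤ w.1) :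
    AbsolutelyContinuousOnInterval (fun s => (γ s).1) z.1 w.1 := by
  refine ((absolutelyContinuousOnInterval_const z.2.1 z.1 w.1).add
    ((H.intervalIntegrable_mul hzw).absolutelyContinuousOnInterval_intervalIntegral
      left_mem_uIcc)).congr fun s hs => ?_
  rw [uIcc_of_le hzw] at hs
  exact (H.fst_eq s hs).symm

theorem absolutelyContinuousOnInterval_snd (H : IsTrajectory z w ω γ) (hzw : z.1 ≤ w.1) :
    AbsolutelyContinuousOnInterval (fun s => (γ s).2) z.1 w.1 := by
  refine ((absolutelyContinuousOnInterval_const z.2.2 z.1 w.1).add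
    ((H.continuousOn_fst hzw).intervalIntegrable.absolutelyContinuousOnInterval_intervalIntegral
      left_mem_uIcc)).congr fun s hs => ?_
  rw [uIcc_of_le hzw] at hs
  exact (H.snd_eq s hs).symm

theorem fst_sub_fst (H : IsTrajectory z w ω γ) {s r : ℝ} (hs : s ∈ Icc z.1 w.1)
    (hr : r ∈ Icc z.1 w.1) : (γ r).1 - (γ s).1 = ∫ u in s..r, ω u * (γ u).1 := by
  have hzw := hs.1.trans hs.2
  have hi := H.intervalIntegrable_mul hzw
  rw [H.fst_eq s hs, H.fst_eq r hr, add_sub_add_left_eq_sub]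
  rw [← uIcc_of_le hzw] at hs hr
  exact intervalIntegral.integral_interval_sub_left
    (hi.mono_set (uIcc_subset_uIcc left_mem_uIcc hr))
    (hi.mono_set (uIcc_subset_uIcc left_mem_uIcc hs))

theorem snd_sub_snd (H : IsTrajectory z w ω γ) {s r : ℝ} (hs : s ∈ Icc z.1 w.1)
    (hr : r ∈ Icc z.1 w.1) : (γ r).2 - (γ s).2 = ∫ u in s..r, (γ u).1 := by
  have hzw := hs.1.trans hs.2
  have hi := (H.continuousOn_fst hzw).intervalIntegrable (μ := volume)
  rw [H.snd_eq s hs, H.snd_eq r hr, add_sub_add_left_eq_sub]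
  rw [← uIcc_of_le hzw] at hs hr
  exact intervalIntegral.integral_interval_sub_left
    (hi.mono_set (uIcc_subset_uIcc left_mem_uIcc hr))
    (hi.mono_set (uIcc_subset_uIcc left_mem_uIcc hs))

theorem prec (H : IsTrajectory z w ω γ) {s : ℝ} (hs : s ∈ Ico z.1 w.1) : Prec (s, γ s) w := by
  refine ⟨hs.2, ?_⟩
  have hT : w.1 ∈ Icc z.1 w.1 := right_mem_Icc.2 (hs.1.trans hs.2.le)
  have e := H.snd_sub_snd (Ico_subset_Icc_self hs) hT
  rw [H.right_eq] at e
  have hsub : Icc s w.1 ⊆ Icc z.1 w.1 := Icc_subset_Icc_left hs.1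
  have hc : ContinuousOn (fun u => (γ u).1) (uIcc s w.1) := by
    rw [uIcc_of_le hs.2.le]
    exact continuous_fst.comp_continuousOn (H.continuousOn.mono hsub)
  have : 0 < ∫ u in s..w.1, (γ u).1 :=
    intervalIntegral.intervalIntegral_pos_of_pos_on hc.intervalIntegrable
      (fun u hu => H.mem_D u (hsub (Ioo_subset_Icc_self hu))) hs.2
  change (γ s).2 < w.2.2
  linarith

theorem ae_hasDerivAt (H : IsTrajectory z w ω γ) (hzw : z.1 ≤ w.1) :
    ∀ᵐ s, s ∈ uIcc z.1 w.1 → HasDerivAt (fun r => (γ r).1) (ω s * (γ s).1) s ∧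
      HasDerivAt (fun r => (γ r).2) (γ s).1 s := by
  have h1 : ∀ᵐ s : ℝ, s ≠ z.1 := by simp [ae_iff, measure_singleton]
  have h2 : ∀ᵐ s : ℝ, s ≠ w.1 := by simp [ae_iff, measure_singleton]
  filter_upwards [h1, h2, (H.intervalIntegrable_mul hzw).ae_hasDerivAt_integral,
    ((H.continuousOn_fst hzw).intervalIntegrable (μ := volume)).ae_hasDerivAt_integral]
    with s hs1 hs2 hd1 hd2 hs
  have hnhds : Icc z.1 w.1 ∈ 𝓝 s := by
    rw [uIcc_of_le hzw] at hs
    exact Icc_mem_nhds (lt_of_le_of_ne hs.1 hs1.symm) (lt_of_le_of_ne hs.2 hs2)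
  constructor
  · exact ((hd1 hs z.1 left_mem_uIcc).const_add z.2.1).congr_of_eventuallyEq
      (eventually_of_mem hnhds H.fst_eq)
  · exact ((hd2 hs z.1 left_mem_uIcc).const_add z.2.2).congr_of_eventuallyEq
      (eventually_of_mem hnhds H.snd_eq)

/-- The verification identity: along a trajectory, the cost exceeds the decrease of the value by
the squared defect of the feedback law. -/
theorem integral_sq_eq (H : IsTrajectory z w ω γ) (hw : 0 < w.2.1) {s : ℝ}
    (hs : s ∈ Ico z.1 w.1) :
    IntervalIntegrable (fun r => (ω r + (γ r).1 / 2 * valueX1 w (r, γ r)) ^ 2) volume z.1 s ∧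
      ∫ r in z.1..s, ω r ^ 2 = value w z - value w (s, γ s) +
        ∫ r in z.1..s, (ω r + (γ r).1 / 2 * valueX1 w (r, γ r)) ^ 2 := by
  have hzw : z.1 ≤ w.1 := hs.1.trans hs.2.le
  have hsub : uIcc z.1 s ⊆ uIcc z.1 w.1 := by
    rw [uIcc_of_le hs.1, uIcc_of_le hzw]
    exact Icc_subset_Icc_right hs.2.le
  have hmem : ∀ r ∈ uIcc z.1 s, r ∈ Ico z.1 w.1 := fun r hr => by
    rw [uIcc_of_le hs.1] at hr
    exact ⟨hr.1, hr.2.trans_lt hs.2⟩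
  have hpos : ∀ r ∈ uIcc z.1 s, 0 < (γ r).1 := fun r hr =>
    H.mem_D r (Ico_subset_Icc_self (hmem r hr))
  have hAC := absolutelyContinuousOnInterval_value hw
    ((H.absolutelyContinuousOnInterval_fst hzw).mono hsub)
    ((H.absolutelyContinuousOnInterval_snd hzw).mono hsub) hpos fun r hr => H.prec (hmem r hr)
  have hω2 := (H.intervalIntegrable_sq hzw).mono_set hsub
  have hder : ∀ᵐ r, r ∈ uIcc z.1 s → deriv (fun r => value w (r, (γ r).1, (γ r).2)) r + ω r ^ 2 =
      (ω r + (γ r).1 / 2 * valueX1 w (r, γ r)) ^ 2 := by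
    filter_upwards [H.ae_hasDerivAt hzw] with r hr hrs
    obtain ⟨hr1, hr2⟩ := hr (hsub hrs)
    have hP := H.prec (hmem r hrs)
    rw [(hasDerivAt_value_comp hw (hpos r hrs) hP (hasDerivAt_id' r) hr1 hr2).deriv]
    have hjb := valueT_add_mul_valueX2 (z := (r, γ r)) hw (hpos r hrs) hP
    simp only [Prod.mk.eta] at hjb ⊢
    -- By HJB, dV/ds + ω² = (γ₁V₁/2)² + ωγ₁V₁ + ω² with V₁ = ∂V/∂x₁, a perfect square.
    linear_combination hjb
  have hint := hAC.intervalIntegrable_deriv.add hω2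
  have hae : (fun r => deriv (fun r => value w (r, (γ r).1, (γ r).2)) r + ω r ^ 2)
      =ᵐ[volume.restrict (uIoc z.1 s)]
      fun r => (ω r + (γ r).1 / 2 * valueX1 w (r, γ r)) ^ 2 := by
    rw [Filter.EventuallyEq, ae_restrict_iff' measurableSet_uIoc]
    filter_upwards [hder] with r hr hrs using hr (uIoc_subset_uIcc hrs)
  refine ⟨hint.congr_ae hae, ?_⟩
  rw [← intervalIntegral.integral_congr_ae_restrict hae,
    intervalIntegral.integral_add hAC.intervalIntegrable_deriv hω2, hAC.integral_deriv_eq_sub]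
  have hz : value w (z.1, (γ z.1).1, (γ z.1).2) = value w z := by rw [H.left_eq]
  rw [hz]
  ring

/-- Let J(s) be the energy of ω on [s,T] and M a bound of γ₁. By Cauchy–Schwarz, γ₁ stays within e =
M√((T-s)J(s)) of y₁ on [s,T], so e²/(T-s) = M²J(s) → 0. -/
theorem exists_value_le (H : IsTrajectory z w ω γ) (hw : 0 < w.2.1) (hzw : z.1 < w.1) :
    ∃ g : ℝ → ℝ, Tendsto g (𝓝[<] w.1) (𝓝 0) ∧ ∀ᶠ s in 𝓝[<] w.1, value w (s, γ s) ≤ g s := by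
  obtain ⟨M, hM⟩ := isCompact_uIcc.exists_bound_of_continuousOn (H.continuousOn_fst hzw.le)
  have hT : w.1 ∈ Icc z.1 w.1 := right_mem_Icc.2 hzw.le
  have hM0 : 0 ≤ M := (norm_nonneg _).trans (hM w.1 right_mem_uIcc)
  obtain ⟨K, η, hη, hK⟩ := AsianControl.exists_value_le (T := w.1) (y₂ := w.2.2) hw
  have hω := H.intervalIntegrable hzw.le
  have hω2 := H.intervalIntegrable_sq hzw.le
  set J : ℝ → ℝ := fun s => ∫ r in s..w.1, ω r ^ 2 with hJ
  have hJ0 : Tendsto J (𝓝[<] w.1) (𝓝 0) := by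
    have hc : ContinuousOn J (uIcc z.1 w.1) := by
      have := intervalIntegral.continuousOn_primitive_interval' hω2 right_mem_uIcc
      refine this.neg.congr fun s _ => ?_
      exact intervalIntegral.integral_symm _ _
    have hcw := hc w.1 right_mem_uIcc
    rw [uIcc_of_le hzw.le] at hcw
    have hle : 𝓝[<] w.1 ≤ 𝓝[Icc z.1 w.1] w.1 := by
      rw [← nhdsWithin_Ioo_eq_nhdsLT hzw]
      exact nhdsWithin_mono _ Ioo_subset_Icc_self
    have := hcw.tendsto.mono_left hle
    simpa [hJ] using this
  set e : ℝ → ℝ := fun s => M * √((w.1 - s) * J s) with he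
  have he0 : Tendsto e (𝓝[<] w.1) (𝓝 0) := by
    have h1 : Tendsto (fun s => w.1 - s) (𝓝[<] w.1) (𝓝 0) := by
      have : Tendsto (fun s => w.1 - s) (𝓝 w.1) (𝓝 (w.1 - w.1)) :=
        tendsto_const_nhds.sub tendsto_id
      rw [sub_self] at this
      exact this.mono_left nhdsWithin_le_nhds
    have := ((Real.continuous_sqrt.tendsto _).comp (h1.mul hJ0)).const_mul M
    simpa [he] using this
  refine ⟨fun s => K * (M ^ 2 * J s), by simpa using (hJ0.const_mul (M ^ 2)).const_mul K, ?_⟩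
  filter_upwards [he0.eventually_lt_const hη, Ioo_mem_nhdsLT hzw] with s hes hs
  have hsI : s ∈ Icc z.1 w.1 := Ioo_subset_Icc_self hs
  have hτ : 0 < w.1 - s := sub_pos.2 hs.2
  have hsub : uIcc s w.1 ⊆ uIcc z.1 w.1 := by
    rw [uIcc_of_le hs.2.le, uIcc_of_le hzw.le]
    exact Icc_subset_Icc_left hs.1.le
  have hJs : 0 ≤ J s := intervalIntegral.integral_nonneg hs.2.le fun r _ => sq_nonneg _
  have hI : ∫ r in s..w.1, |ω r| ≤ √((w.1 - s) * J s) :=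
    Real.le_sqrt_of_sq_le
      (sq_intervalIntegral_abs_le hs.2 (hω.mono_set hsub) (hω2.mono_set hsub))
  have hdist : ∀ r ∈ Icc s w.1, |(γ r).1 - w.2.1| ≤ e s := by
    intro r hr
    have hrI : r ∈ Icc z.1 w.1 := ⟨hs.1.le.trans hr.1, hr.2⟩
    have hdiff := H.fst_sub_fst hrI hT
    have hsub' : uIcc r w.1 ⊆ uIcc z.1 w.1 := by
      rw [uIcc_of_le hr.2, uIcc_of_le hzw.le]
      exact Icc_subset_Icc_left hrI.1
    rw [H.right_eq] at hdiff
    rw [abs_sub_comm, hdiff]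
    calc |∫ u in r..w.1, ω u * (γ u).1| ≤ ∫ u in r..w.1, |ω u * (γ u).1| :=
          intervalIntegral.abs_integral_le_integral_abs hr.2
      _ ≤ ∫ u in r..w.1, M * |ω u| := by
          refine intervalIntegral.integral_mono_on hr.2
            ((H.intervalIntegrable_mul hzw.le).mono_set hsub').abs
            ((hω.mono_set hsub').abs.const_mul M) fun u hu => ?_
          rw [abs_mul, mul_comm]
          gcongr
          exact hM u (hsub' (by rwa [uIcc_of_le hr.2]))
      _ = M * ∫ u in r..w.1, |ω u| := intervalIntegral.integral_const_mul _ _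
      _ ≤ M * ∫ u in s..w.1, |ω u| := by
          gcongr
          refine intervalIntegral.integral_mono_interval hr.1 hr.2 le_rfl
            (Eventually.of_forall fun u => abs_nonneg _) (hω.mono_set hsub).abs
      _ ≤ e s := by
          simp only [he]
          gcongr
  have hA : |w.2.2 - (γ s).2 - (w.1 - s) * w.2.1| ≤ (w.1 - s) * e s := by
    have hdiff := H.snd_sub_snd hsI hT
    rw [H.right_eq] at hdiff
    have hc := ((H.continuousOn_fst hzw.le).mono hsub).intervalIntegrable (μ := volume)
    have : w.2.2 - (γ s).2 - (w.1 - s) * w.2.1 = ∫ u in s..w.1, ((γ u).1 - w.2.1) := by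
      rw [intervalIntegral.integral_sub hc intervalIntegrable_const,
        intervalIntegral.integral_const, ← hdiff, smul_eq_mul]
    rw [this]
    have hn := intervalIntegral.norm_integral_le_of_norm_le_const (a := s) (b := w.1)
      (f := fun u => (γ u).1 - w.2.1) (C := e s) fun u hu => by
        rw [uIoc_of_le hs.2.le] at hu
        exact hdist u (Ioc_subset_Icc_self hu)
    rwa [Real.norm_eq_abs, abs_of_pos hτ, mul_comm] at hn
  refine (hK s (γ s).1 (γ s).2 (e s) hs.2 (by positivity) hes (hdist s (left_mem_Icc.2 hs.2.le))
    hA).trans (le_of_eq ?_)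
  simp only [he]
  rw [mul_pow, Real.sq_sqrt (by positivity)]
  field_simp

theorem intervalIntegral_sq_le_cost (H : IsTrajectory z w ω γ) {s : ℝ} (hs : s ∈ Ico z.1 w.1) :
    ∫ r in z.1..s, ω r ^ 2 ≤ cost z w ω := by
  simp only [cost, sq_abs]
  exact intervalIntegral.integral_mono_interval le_rfl hs.1 hs.2.le
    (Eventually.of_forall fun _ => sq_nonneg _) (H.intervalIntegrable_sq (hs.1.trans hs.2.le))

/-- Apply the verification identity up to r > s and let r → T: the defect on [t,s] is at most that
on [t,r], and the upper bound of V(r,γ(r)) tends to 0. -/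
theorem integral_defect_le (H : IsTrajectory z w ω γ) (hw : 0 < w.2.1) {s : ℝ}
    (hs : s ∈ Ico z.1 w.1) :
    ∫ r in z.1..s, (ω r + (γ r).1 / 2 * valueX1 w (r, γ r)) ^ 2 ≤ cost z w ω - value w z := by
  have hzw := hs.1.trans_lt hs.2
  obtain ⟨g, hg, hle⟩ := H.exists_value_le hw hzw
  have hlim : Tendsto (fun s => cost z w ω - value w z + g s) (𝓝[<] w.1)
      (𝓝 (cost z w ω - value w z + 0)) := hg.const_add _
  rw [add_zero] at hlim
  refine ge_of_tendsto hlim ?_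
  filter_upwards [hle, Ioo_mem_nhdsLT hs.2] with r hr hrs
  have hrI : r ∈ Ico z.1 w.1 := ⟨hs.1.trans hrs.1.le, hrs.2⟩
  obtain ⟨hint, heq⟩ := H.integral_sq_eq hw hrI
  have h1 := H.intervalIntegral_sq_le_cost hrI
  have h2 : ∫ r in z.1..s, (ω r + (γ r).1 / 2 * valueX1 w (r, γ r)) ^ 2 ≤
      ∫ r in z.1..r, (ω r + (γ r).1 / 2 * valueX1 w (r, γ r)) ^ 2 :=
    intervalIntegral.integral_mono_interval le_rfl hs.1 hrs.1.le
      (Eventually.of_forall fun _ => sq_nonneg _) hint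
  linarith

theorem value_le_cost (H : IsTrajectory z w ω γ) (hw : 0 < w.2.1) (hzw : z.1 < w.1) :
    value w z ≤ cost z w ω := by
  have := H.integral_defect_le hw (left_mem_Ico.2 hzw)
  rw [intervalIntegral.integral_same] at this
  linarith

theorem ae_eq_feedback (H : IsTrajectory z w ω γ) (hw : 0 < w.2.1) (hzw : z.1 < w.1)
    (hcost : cost z w ω ≤ value w z) :
    ∀ᵐ s ∂(volume.restrict (Icc z.1 w.1)),
      ω s = -((γ s).1 / 2) * valueX1 w (s, γ s) := by
  have key : ∀ s ∈ Ico z.1 w.1, ∀ᵐ r, r ∈ Ioc z.1 s →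
      ω r = -((γ r).1 / 2) * valueX1 w (r, γ r) := by
    intro s hs
    have hle := H.integral_defect_le hw hs
    obtain ⟨hint, -⟩ := H.integral_sq_eq hw hs
    have h0 : ∫ r in z.1..s, (ω r + (γ r).1 / 2 * valueX1 w (r, γ r)) ^ 2 = 0 :=
      le_antisymm (by linarith) (intervalIntegral.integral_nonneg hs.1 fun _ _ => sq_nonneg _)
    rw [intervalIntegral.integral_eq_zero_iff_of_le_of_nonneg_ae hs.1
      (Eventually.of_forall fun _ => sq_nonneg _) hint] at h0
    rw [Filter.EventuallyEq, ae_restrict_iff' measurableSet_Ioc] at h0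
    filter_upwards [h0] with r hr hrs
    have := pow_eq_zero_iff (two_ne_zero) |>.1 (hr hrs)
    linarith
  -- The feedback law is known on each [t,s] with s < T; countably many of these exhaust [t,T[.
  obtain ⟨u, -, hu, hlim⟩ := exists_seq_strictMono_tendsto' hzw
  have hall := ae_all_iff.2 fun n => key (u n) (Ioo_subset_Ico_self (hu n))
  have h1 : ∀ᵐ s : ℝ, s ≠ z.1 := by simp [ae_iff, measure_singleton]
  have h2 : ∀ᵐ s : ℝ, s ≠ w.1 := by simp [ae_iff, measure_singleton]
  rw [ae_restrict_iff' measurableSet_Icc]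
  filter_upwards [hall, h1, h2] with s hs hs1 hs2 hsI
  obtain ⟨n, hn⟩ := (hlim.eventually_const_lt (lt_of_le_of_ne hsI.2 hs2)).exists
  exact hs n ⟨lt_of_le_of_ne hsI.1 hs1.symm, hn.le⟩

theorem cost_le_value (H : IsTrajectory z w ω γ) (hw : 0 < w.2.1) (hzw : z.1 < w.1)
    (hfeed : ∀ s ∈ Ico z.1 w.1, ω s = -((γ s).1 / 2) * valueX1 w (s, γ s)) :
    cost z w ω ≤ value w z := by
  have hω2 := H.intervalIntegrable_sq hzw.le
  have hle : 𝓝[<] w.1 ≤ 𝓝[uIcc z.1 w.1] w.1 := by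
    rw [← nhdsWithin_Ioo_eq_nhdsLT hzw, uIcc_of_le hzw.le]
    exact nhdsWithin_mono _ Ioo_subset_Icc_self
  have hlim : Tendsto (fun s => ∫ r in z.1..s, ω r ^ 2) (𝓝[<] w.1) (𝓝 (cost z w ω)) := by
    simp only [cost, sq_abs]
    exact (intervalIntegral.continuousOn_primitive_interval' hω2 left_mem_uIcc w.1
      right_mem_uIcc).tendsto.mono_left hle
  refine le_of_tendsto hlim ?_
  filter_upwards [Ioo_mem_nhdsLT hzw] with s hs
  have hsI := Ioo_subset_Ico_self hs
  obtain ⟨-, heq⟩ := H.integral_sq_eq hw hsI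
  have h0 : ∫ r in z.1..s, (ω r + (γ r).1 / 2 * valueX1 w (r, γ r)) ^ 2 = 0 := by
    rw [intervalIntegral.integral_congr (g := fun _ => 0), intervalIntegral.integral_zero]
    intro r hr
    rw [uIcc_of_le hs.1.le] at hr
    simp only
    rw [hfeed r ⟨hr.1, hr.2.trans_lt hs.2⟩]
    ring
  have := value_nonneg (z := (s, γ s)) hw (H.mem_D s (Ico_subset_Icc_self hsI)) (H.prec hsI)
  linarith

end IsTrajectory

end AsianControl

/-! ### The explicit optimal trajectory -/

namespace AsianControl

/-- The solution of `v'' = k v` with `v 0 = 0` and `v' 0 = 1`. -/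
noncomputable def genSin (k r : ℝ) : ℝ := r * sinhcSqrt (k * r ^ 2)

/-- The solution of `v'' = k v` with `v 0 = 1` and `v' 0 = 0`. -/
noncomputable def genCos (k r : ℝ) : ℝ := coshSqrt (k * r ^ 2)

@[simp] theorem genSin_zero (k : ℝ) : genSin k 0 = 0 := by simp [genSin]

@[simp] theorem genCos_zero (k : ℝ) : genCos k 0 = 1 := by simp [genCos]

theorem hasDerivAt_genSin (k r : ℝ) : HasDerivAt (genSin k) (genCos k r) r := by
  have h1 : HasDerivAt (fun r : ℝ => k * r ^ 2) (k * (2 * r)) r := by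
    simpa using (hasDerivAt_pow 2 r).const_mul k
  have h2 := (hasDerivAt_id' r).fun_mul ((hasDerivAt_sinhcSqrt _).comp r h1)
  refine h2.congr_deriv ?_
  simp only [genCos, Function.comp_apply]
  linear_combination two_mul_sinhcSqrtDeriv (k * r ^ 2)

theorem hasDerivAt_genCos (k r : ℝ) : HasDerivAt (genCos k) (k * genSin k r) r := by
  have h1 : HasDerivAt (fun r : ℝ => k * r ^ 2) (k * (2 * r)) r := by
    simpa using (hasDerivAt_pow 2 r).const_mul k
  refine ((hasDerivAt_coshSqrt _).comp r h1).congr_deriv ?_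
  simp only [genSin]
  ring

/-- The right-hand side, taken at a + b - r and r, has zero derivative in r; compare r = 0 with r =
b. -/
theorem genSin_add (k a b : ℝ) :
    genSin k (a + b) = genSin k a * genCos k b + genCos k a * genSin k b := by
  set F : ℝ → ℝ := fun r => genSin k (a + b - r) * genCos k r + genCos k (a + b - r) * genSin k r
    with hF
  have hd : ∀ r, HasDerivAt F 0 r := fun r => by
    have hr : HasDerivAt (fun r => a + b - r) (-1) r := (hasDerivAt_id' r).const_sub (a + b)
    refine ((((hasDerivAt_genSin k _).comp r hr).fun_mul (hasDerivAt_genCos k r)).fun_add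
      (((hasDerivAt_genCos k _).comp r hr).fun_mul (hasDerivAt_genSin k r))).congr_deriv ?_
    simp only [Function.comp_apply]
    ring
  have := is_const_of_deriv_eq_zero (fun r => (hd r).differentiableAt) (fun r => (hd r).deriv) 0 b
  simpa [hF] using this

theorem neg_pi_sq_lt_mul_sq {k r τ : ℝ} (hr : 0 ≤ r) (hrτ : r ≤ τ)
    (hk : -Real.pi ^ 2 < k * τ ^ 2) : -Real.pi ^ 2 < k * r ^ 2 := by
  rcases le_or_gt 0 k with h | h
  · have := mul_nonneg h (sq_nonneg r)
    have := pow_pos Real.pi_pos 2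
    linarith
  · have : r ^ 2 ≤ τ ^ 2 := by gcongr
    nlinarith

theorem genSin_pos {k r τ : ℝ} (hr : 0 < r) (hrτ : r ≤ τ) (hk : -Real.pi ^ 2 < k * τ ^ 2) :
    0 < genSin k r :=
  mul_pos hr (sinhcSqrt_pos (neg_pi_sq_lt_mul_sq hr.le hrτ hk))

theorem genSin_nonneg {k r τ : ℝ} (hr : 0 ≤ r) (hrτ : r ≤ τ) (hk : -Real.pi ^ 2 < k * τ ^ 2) :
    0 ≤ genSin k r :=
  mul_nonneg hr (sinhcSqrt_pos (neg_pi_sq_lt_mul_sq hr hrτ hk)).le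

/-- The explicit optimal trajectory `γ₁ = v ^ (-2)` with `v'' = k v`. -/
theorem exists_feedback_trajectory {w z : ℝ × ℝ × ℝ} (hw : 0 < w.2.1) (hz : 0 < z.2.1)
    (h : Prec z w) :
    ∃ (ω : ℝ → ℝ) (γ : ℝ → ℝ × ℝ), IsTrajectory z w ω γ ∧ ContinuousOn ω (Icc z.1 w.1) ∧
      ∀ s ∈ Ico z.1 w.1, ω s = -((γ s).1 / 2) * valueX1 w (s, γ s) := by
  have hS := sinhcSqrt_rate hw hz h
  have hτ : 0 < w.1 - z.1 := sub_pos.2 h.1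
  have hA : 0 < w.2.2 - z.2.2 := sub_pos.2 h.2
  have hm : -Real.pi ^ 2 < rate w z := invSinhcSqrt_mem (by positivity)
  obtain ⟨t, x₁, x₂⟩ := z
  obtain ⟨T, y₁, y₂⟩ := w
  simp only at *
  generalize rate _ _ = m at *
  set k := m / (T - t) ^ 2 with hk
  have hkm : k * (T - t) ^ 2 = m := by rw [hk]; field_simp
  have hkpi : -Real.pi ^ 2 < k * (T - t) ^ 2 := by rwa [hkm]
  obtain ⟨p, hp, rfl⟩ : ∃ p : ℝ, 0 < p ∧ 1 / p ^ 2 = x₁ :=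
    ⟨(√x₁)⁻¹, by positivity, by rw [inv_pow, Real.sq_sqrt hz.le, one_div, inv_inv]⟩
  obtain ⟨q, hq, rfl⟩ : ∃ q : ℝ, 0 < q ∧ 1 / q ^ 2 = y₁ :=
    ⟨(√y₁)⁻¹, by positivity, by rw [inv_pow, Real.sq_sqrt hw.le, one_div, inv_inv]⟩
  have hsqrt : ∀ {a b : ℝ}, 0 < a → 0 < b → √(1 / a ^ 2 * (1 / b ^ 2)) = 1 / (a * b) := by
    intro a b ha hb
    rw [show 1 / a ^ 2 * (1 / b ^ 2) = (1 / (a * b)) ^ 2 by field_simp]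
    exact Real.sqrt_sq (by positivity)
  -- The defining equation of m, which will give γ₂(t) = x₂.
  have hστ : genSin k (T - t) = (y₂ - x₂) * (p * q) := by
    rw [genSin, hkm, hS, hsqrt hp hq]
    field_simp
  have hσ0 : 0 < genSin k (T - t) := by rw [hστ]; positivity
  -- The solution of v'' = kv with v(t) = p = x₁^(-1/2) and v(T) = q = y₁^(-1/2).
  set v : ℝ → ℝ := fun s => (q * genSin k (s - t) + p * genSin k (T - s)) / genSin k (T - t)
    with hv
  set v' : ℝ → ℝ := fun s => (q * genCos k (s - t) - p * genCos k (T - s)) / genSin k (T - t)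
    with hv'
  have hdσ : ∀ s, HasDerivAt (fun s => genSin k (T - s)) (-genCos k (T - s)) s := fun s => by
    refine ((hasDerivAt_genSin k (T - s)).comp s ((hasDerivAt_id' s).const_sub T)).congr_deriv ?_
    ring
  have hdv : ∀ s, HasDerivAt v (v' s) s := fun s => by
    have h1 : HasDerivAt (fun s => genSin k (s - t)) (genCos k (s - t)) s := by
      refine ((hasDerivAt_genSin k (s - t)).comp s ((hasDerivAt_id' s).sub_const t)).congr_deriv ?_
      ring
    refine (((h1.const_mul q).fun_add ((hdσ s).const_mul p)).div_const _).congr_deriv ?_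
    simp only [hv']
    ring
  have hvpos : ∀ s ∈ Icc t T, 0 < v s := fun s hs => by
    refine div_pos ?_ hσ0
    have h1 := genSin_nonneg (sub_nonneg.2 hs.1) (by linarith [hs.2]) hkpi
    have h2 := genSin_nonneg (sub_nonneg.2 hs.2) (by linarith [hs.1]) hkpi
    rcases eq_or_lt_of_le hs.1 with rfl | h3
    · positivity
    · have := genSin_pos (sub_pos.2 h3) (by linarith [hs.2]) hkpi
      positivity
  -- A constant Wronskian. It makes -`genSin k (T - s)`/(q v) a primitive of v⁻², whence the formula
  -- for γ₂, and it also yields the feedback law.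
  have hwron : ∀ s, genCos k (T - s) * v s + genSin k (T - s) * v' s = q := fun s => by
    have hadd := genSin_add k (T - s) (s - t)
    rw [show T - s + (s - t) = T - t by ring] at hadd
    simp only [hv, hv']
    field_simp
    linear_combination -q * hadd
  have hvt : v t = p := by simp [hv, hσ0.ne']
  have hvT : v T = q := by simp [hv, hσ0.ne']
  have hcv : Continuous v := continuous_iff_continuousAt.2 fun s => (hdv s).continuousAt
  have hcC : Continuous (genCos k) :=
    continuous_iff_continuousAt.2 fun s => (hasDerivAt_genCos k s).continuousAt
  have hcv' : Continuous v' := by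
    simp only [hv']
    fun_prop
  have hcσ : Continuous fun s => genSin k (T - s) :=
    continuous_iff_continuousAt.2 fun s => (hdσ s).continuousAt
  set ω : ℝ → ℝ := fun s => -2 * v' s / v s with hω
  set γ : ℝ → ℝ × ℝ := fun s => (1 / v s ^ 2, y₂ - genSin k (T - s) / (q * v s)) with hγ
  have hcω : ContinuousOn ω (Icc t T) :=
    ContinuousOn.div (by fun_prop) hcv.continuousOn fun s hs => (hvpos s hs).ne'
  have hcγ1 : ContinuousOn (fun s => 1 / v s ^ 2) (Icc t T) :=
    ContinuousOn.div (by fun_prop) (by fun_prop) fun s hs => (pow_pos (hvpos s hs) 2).ne'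
  have hcγ2 : ContinuousOn (fun s => y₂ - genSin k (T - s) / (q * v s)) (Icc t T) :=
    continuousOn_const.sub <| ContinuousOn.div hcσ.continuousOn (by fun_prop)
      fun s hs => (mul_pos hq (hvpos s hs)).ne'
  have hd1 : ∀ s ∈ Icc t T, HasDerivAt (fun s => 1 / v s ^ 2) (ω s * (γ s).1) s := fun s hs => by
    have h0 := hvpos s hs
    have := ((hdv s).fun_pow 2).fun_inv (pow_pos h0 2).ne'
    simp only [one_div]
    refine this.congr_deriv ?_
    simp only [hω, hγ]
    field_simp
    ring
  have hd2 : ∀ s ∈ Icc t T, HasDerivAt (fun s => y₂ - genSin k (T - s) / (q * v s)) (γ s).1 s :=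
    fun s hs => by
      have h0 := hvpos s hs
      have := ((hdσ s).fun_div ((hdv s).const_mul q) (mul_pos hq h0).ne').const_sub y₂
      refine this.congr_deriv ?_
      simp only [hγ]
      field_simp
      linear_combination hwron s
  have hsubIcc : ∀ s ∈ Icc t T, uIcc t s ⊆ Icc t T := fun s hs => by
    rw [uIcc_of_le hs.1]
    exact Icc_subset_Icc_right hs.2
  have hleft : γ t = (1 / p ^ 2, x₂) := by
    simp only [hγ, hvt, hστ]
    congr 1
    field_simp
    ring
  refine ⟨ω, γ, ⟨?_, ?_, hcγ1.prodMk hcγ2, ?_, ?_, hleft, ?_⟩, hcω, ?_⟩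
  · obtain ⟨C, hC⟩ := isCompact_Icc.exists_bound_of_continuousOn hcω
    exact MemLp.of_bound (hcω.aestronglyMeasurable measurableSet_Icc) C
      (ae_restrict_of_forall_mem measurableSet_Icc hC)
  · intro s hs
    have := hvpos s hs
    change 0 < 1 / v s ^ 2
    positivity
  · intro s hs
    simp only at hs ⊢
    rw [intervalIntegral.integral_eq_sub_of_hasDerivAt (fun r hr => hd1 r (hsubIcc s hs hr))
      ((hcω.mul hcγ1).mono (hsubIcc s hs)).intervalIntegrable, hvt]
    simp only [hγ]
    ring
  · intro s hs
    simp only at hs ⊢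
    rw [intervalIntegral.integral_eq_sub_of_hasDerivAt (fun r hr => hd2 r (hsubIcc s hs hr))
      (hcγ1.mono (hsubIcc s hs)).intervalIntegrable]
    have := congrArg Prod.snd hleft
    simp only [hγ] at this ⊢
    rw [this]
    ring
  · simp [hγ, hvT]
  · intro s hs
    have hv0 := hvpos s (Ico_subset_Icc_self hs)
    have hTs : 0 < T - s := sub_pos.2 hs.2
    have hσs : 0 < genSin k (T - s) := genSin_pos hTs (by linarith [hs.1]) hkpi
    -- The remaining arc has the same k: here A/((T-s)ρ) = `genSin k (T - s)`/(T-s) = S(k(T-s)²).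
    have hrate : rate (T, 1 / q ^ 2, y₂) (s, γ s) = k * (T - s) ^ 2 := by
      rw [← invSinhcSqrt_sinhcSqrt (neg_pi_sq_lt_mul_sq hTs.le (by linarith [hs.1]) hkpi), rate]
      congr 1
      simp only [hγ]
      rw [hsqrt hv0 hq, sub_sub_cancel, genSin]
      field_simp
    have hcos : coshSqrt (k * (T - s) ^ 2) = genCos k (T - s) := rfl
    rw [valueX1, hrate, hcos]
    simp only [hγ, hω]
    rw [hsqrt hv0 hq, sub_sub_cancel]
    have := hwron s
    field_simp
    linear_combination -4 * this

/-! ### Identification of Ψ with V -/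

theorem isLeast_value {w z : ℝ × ℝ × ℝ} (hw : 0 < w.2.1) (hz : 0 < z.2.1) (h : Prec z w) :
    IsLeast {c : ℝ | ∃ ω γ, IsTrajectory z w ω γ ∧ c = cost z w ω} (value w z) := by
  obtain ⟨ω, γ, H, -, hfeed⟩ := exists_feedback_trajectory hw hz h
  refine ⟨⟨ω, γ, H, le_antisymm (H.value_le_cost hw h.1) (H.cost_le_value hw h.1 hfeed)⟩, ?_⟩
  rintro _ ⟨ω', γ', H', rfl⟩
  exact H'.value_le_cost hw h.1

theorem Psi_eq_value {w z : ℝ × ℝ × ℝ} (hw : 0 < w.2.1) (hz : 0 < z.2.1) (h : Prec z w) :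
    Psi z w = value w z :=
  (isLeast_value hw hz h).csInf_eq

/-- The conditions on z are open, so differentiability and derivatives pass from V to Ψ. -/
theorem Psi_eventuallyEq_value {w z : ℝ × ℝ × ℝ} (hw : 0 < w.2.1) (hz : 0 < z.2.1)
    (h : Prec z w) : (fun ζ => Psi ζ w) =ᶠ[𝓝 z] value w := by
  have h1 : ∀ᶠ ζ : ℝ × ℝ × ℝ in 𝓝 z, 0 < ζ.2.1 :=
    (continuous_fst.comp continuous_snd).continuousAt.eventually_const_lt hz
  have h2 : ∀ᶠ ζ : ℝ × ℝ × ℝ in 𝓝 z, ζ.1 < w.1 :=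
    continuous_fst.continuousAt.eventually_lt_const h.1
  have h3 : ∀ᶠ ζ : ℝ × ℝ × ℝ in 𝓝 z, ζ.2.2 < w.2.2 :=
    (continuous_snd.comp continuous_snd).continuousAt.eventually_lt_const h.2
  filter_upwards [h1, h2, h3] with ζ hζ1 hζ2 hζ3 using Psi_eq_value hw hζ1 ⟨hζ2, hζ3⟩

theorem deriv_Psi_comp {w z : ℝ × ℝ × ℝ} (hw : 0 < w.2.1) (hz : 0 < z.2.1) (h : Prec z w)
    {t x₁ x₂ : ℝ → ℝ} {t' x₁' x₂' s : ℝ} (hs : (t s, x₁ s, x₂ s) = z) (ht : HasDerivAt t t' s)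
    (hx₁ : HasDerivAt x₁ x₁' s) (hx₂ : HasDerivAt x₂ x₂' s) :
    deriv (fun r => Psi (t r, x₁ r, x₂ r) w) s =
      t' * valueT w z + x₁' * valueX1 w z + x₂' * valueX2 w z := by
  subst hs
  have hd := hasDerivAt_value_comp hw hz h ht hx₁ hx₂
  have hc : ContinuousAt (fun r => (t r, x₁ r, x₂ r)) s :=
    ht.continuousAt.prodMk (hx₁.continuousAt.prodMk hx₂.continuousAt)
  exact (hd.congr_of_eventuallyEq
    (hc.tendsto.eventually (Psi_eventuallyEq_value hw hz h))).deriv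

theorem partialT_Psi {w z : ℝ × ℝ × ℝ} (hw : 0 < w.2.1) (hz : 0 < z.2.1) (h : Prec z w) :
    partialT (fun ζ => Psi ζ w) z = valueT w z := by
  have := deriv_Psi_comp hw hz h (s := z.1) rfl (hasDerivAt_id' z.1)
    (hasDerivAt_const z.1 z.2.1) (hasDerivAt_const z.1 z.2.2)
  simpa [partialT] using this

theorem partialX1_Psi {w z : ℝ × ℝ × ℝ} (hw : 0 < w.2.1) (hz : 0 < z.2.1) (h : Prec z w) :
    partialX1 (fun ζ => Psi ζ w) z = valueX1 w z := by
  have := deriv_Psi_comp hw hz h (s := z.2.1) rfl (hasDerivAt_const z.2.1 z.1)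
    (hasDerivAt_id' z.2.1) (hasDerivAt_const z.2.1 z.2.2)
  simpa [partialX1] using this

theorem partialX2_Psi {w z : ℝ × ℝ × ℝ} (hw : 0 < w.2.1) (hz : 0 < z.2.1) (h : Prec z w) :
    partialX2 (fun ζ => Psi ζ w) z = valueX2 w z := by
  have := deriv_Psi_comp hw hz h (s := z.2.2) rfl (hasDerivAt_const z.2.2 z.1)
    (hasDerivAt_const z.2.2 z.2.1) (hasDerivAt_id' z.2.2)
  simpa [partialX2] using this

end AsianControl

theorem lemma4p1 (w : ℝ × ℝ × ℝ) (hw : w.2 ∈ AsianControl.D) :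
    -- the Hamilton-Jacobi-Bellman equation
    (∀ z : ℝ × ℝ × ℝ, z.2 ∈ AsianControl.D → AsianControl.Prec z w →
      DifferentiableAt ℝ (fun ζ => AsianControl.Psi ζ w) z ∧
      AsianControl.fieldY (fun ζ => AsianControl.Psi ζ w) z =
        (z.2.1 / 2 * AsianControl.partialX1 (fun ζ => AsianControl.Psi ζ w) z) ^ 2) ∧
    -- optimal controls: existence and feedback form
    (∀ z : ℝ × ℝ × ℝ, z.2 ∈ AsianControl.D → AsianControl.Prec z w →
      (∃ (ω : ℝ → ℝ) (γ : ℝ → ℝ × ℝ), AsianControl.IsOptimal z w ω γ ∧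
        ContinuousOn ω (Icc z.1 w.1) ∧
        ∀ s ∈ Ico z.1 w.1, ω s =
          -((γ s).1 / 2) * AsianControl.partialX1 (fun ζ => AsianControl.Psi ζ w) (s, γ s)) ∧
      (∀ (ω : ℝ → ℝ) (γ : ℝ → ℝ × ℝ), AsianControl.IsOptimal z w ω γ →
        ∀ᵐ s ∂(volume.restrict (Icc z.1 w.1)), ω s =
          -((γ s).1 / 2) * AsianControl.partialX1 (fun ζ => AsianControl.Psi ζ w) (s, γ s))) := by
  have hfeed : ∀ z : ℝ × ℝ × ℝ, ∀ ω γ, AsianControl.IsTrajectory z w ω γ → ∀ s ∈ Ico z.1 w.1,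
      AsianControl.partialX1 (fun ζ => AsianControl.Psi ζ w) (s, γ s) =
        AsianControl.valueX1 w (s, γ s) := fun z ω γ H s hs =>
    AsianControl.partialX1_Psi hw (H.mem_D s (Ico_subset_Icc_self hs)) (H.prec hs)
  refine ⟨fun z hz h => ⟨?_, ?_⟩, fun z hz h => ⟨?_, fun ω γ hopt => ?_⟩⟩
  · exact (AsianControl.differentiableAt_value hw hz h).congr_of_eventuallyEq
      (AsianControl.Psi_eventuallyEq_value hw hz h)
  · rw [AsianControl.fieldY, AsianControl.partialT_Psi hw hz h,
      AsianControl.partialX1_Psi hw hz h, AsianControl.partialX2_Psi hw hz h,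
      AsianControl.valueT_add_mul_valueX2 hw hz h]
  · obtain ⟨ω, γ, H, hc, hω⟩ := AsianControl.exists_feedback_trajectory hw hz h
    refine ⟨ω, γ, ⟨H, fun ω' γ' H' => ?_⟩, hc, fun s hs => ?_⟩
    · exact (H.cost_le_value hw h.1 hω).trans (H'.value_le_cost hw h.1)
    · rw [hfeed z ω γ H s hs, hω s hs]
  · obtain ⟨ω', γ', H', -, hω'⟩ := AsianControl.exists_feedback_trajectory hw hz h
    have hae := hopt.1.ae_eq_feedback hw h.1
      ((hopt.2 ω' γ' H').trans (H'.cost_le_value hw h.1 hω'))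
    -- At s = T the point (s,γ(s)) is w itself, where the derivative of Ψ is not identified with
    -- that of V.
    have hne : ∀ᵐ s ∂(volume.restrict (Icc z.1 w.1)), s ≠ w.1 :=
      ae_restrict_of_ae (by simp [ae_iff, measure_singleton])
    filter_upwards [hae, hne, ae_restrict_mem measurableSet_Icc] with s hs hsT hsI
    rw [hfeed z ω γ hopt.1 s ⟨hsI.1, lt_of_le_of_ne hsI.2 hsT⟩]
    exact hs
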